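/- Let $\mathbb F$ be a field of characteristic $0$, let $k\ge 1$, let $\mathcal A=M_{k\times k}(\mathbb F)$, and let $E_{p,q}$ be the matrix units. A conformal algebra is a vector space $R$ with a linear map $\partial:R\to R$ and bilinear products $u_nv$ ($n\in\mathbb N=\{0,1,2,\dots\}$), written $Y^+(u,z)v=\sum_{n\ge 0}u_nv\,z^{-n-1}$, such that for all $u,v,w\in R$: $u_nv=0$ for $n\gg0$; $(\partial u)_0v=0$ and $(\partial u)_{n+1}v=-(n+1)u_nv$; $u_nv=\sum_{j\ge0}(-1)^{n+j+1}\frac{\partial^j}{j!}(v_{n+j}u)$; $u_m(v_nw)-v_n(u_mw)=\sum_{j=0}^m\binom mj(u_jv)_{m+n-j}w$. An ideal is a $\partial$-stable subspace $\mathcal I$ with $u_n\mathcal I\subset\mathcal I$ for all $u\in R$, $n\in\mathbb N$. We call $R$ simple if $R\ne0$ and its only ideals are $0$ and $R$. We say that $R$ is generated by $S\subset R$ if $R$ is the span of all $u^1_{m_1}\cdots u^p_{m_p}v$ with $u^j,v\in S$ and $p,m_j\in\mathbb N$. Let $R(\mathcal A)$ be the vector space spanned by symbols $u_{[i,i]}(m,n)$,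 $i\in\{0,1\}$, $u\in\mathcal A$, $m,n\in\mathbb N$, which are linear in $u$ and otherwise independent (a direct sum of copies of $\mathcal A$ indexed by $(i,m,n)$). Put $$\partial u_{[i,i]}(m,n)=(m+1)u_{[i,i]}(m+1,n)+(n+1)u_{[i,i]}(m,n+1),$$ $$Y^+(u_{[i,i]}(m_1,m_2),z)v_{[j,j]}(n_1,n_2)=0\quad\text{for } i\ne j,$$ and, with $\delta=\delta_{i,0}$, $$\begin{aligned}Y^+(u_{[i,i]}(m_1,m_2),z)v_{[i,i]}(n_1,n_2)={}&(n_1\delta+1)\binom{-n_1-1-\delta}{m_2}\sum_{p=0}^{m_1+m_2+n_1+\delta}\binom p{m_1}(uv)_{[i,i]}(p,n_2)\,z^{p-m_1-m_2-n_1-1-\delta}\\&-\bigl(\delta_{i,1}-(n_2+1)\delta\bigr)\binom{-n_2-1-\delta}{m_1}\sum_{q=0}^{m_1+m_2+n_2+\delta}\binom q{m_2}(vu)_{[i,i]}(n_1,q)\,z^{q-m_1-m_2-n_2-1-\delta}.\end{aligned}$$ The weight of $u_{[i,i]}(m,n)$ is $m+n+1+\delta_{i,0}$. For the transpose $\sigma(u)=u^t$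 put $R(\mathcal A)^\sigma=\operatorname{span}\{u_{[i,i]}(m,n)+(-1)^i\sigma(u)_{[i,i]}(n,m)\mid u\in\mathcal A,\ i\in\{0,1\},\ m,n\in\mathbb N\}$. Let $$R^*_{k\times k,1}=\operatorname{span}\{(E_{p,q})_{[1,1]}(m,n)-(E_{q,p})_{[1,1]}(n,m)\mid 1\le p,q\le k,\ m,n\in\mathbb N\},$$ $$R^*_{k\times k,2}=\operatorname{span}\{(E_{p,q})_{[0,0]}(m,n)+(E_{q,p})_{[0,0]}(n,m)\mid 1\le p,q\le k,\ m,n\in\mathbb N\},$$ and let $(R^*_{k\times k,j})^{(2)}$ be the subspace of elements of weight $2$. **Theorem 3.2.** Both $R^*_{k\times k,1}$ and $R^*_{k\times k,2}$ are contained in $R(\mathcal A)^\sigma$, are closed under $\partial$ and all products $u_nv$, are conformal algebras under these operations, and are simple. Moreover: 1. $(R^*_{k\times k,1})^{(2)}=\operatorname{span}\{(E_{p,q})_{[1,1]}(1,0)-(E_{q,p})_{[1,1]}(0,1)\}$, and it generates $R^*_{k\times k,1}$ if $k>1$. If $k=1$, $R^*_{1\times1,1}$ is generated by $(I_1)_{[1,1]}(1,0)-(I_1)_{[1,1]}(0,1)$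 and $(I_1)_{[1,1]}(3,0)-(I_1)_{[1,1]}(0,3)$. 2. $(R^*_{k\times k,2})^{(2)}=\operatorname{span}\{(E_{p,q}+E_{q,p})_{[0,0]}(0,0)\}$, and it generates $R^*_{k\times k,2}$ if $k>1$. If $k=1$, $R^*_{1\times1,2}$ is generated by $(I_1)_{[0,0]}(0,0)$ and $(I_1)_{[0,0]}(1,1)$. 3. Under $u\odot v=u_1v$, the space $(R^*_{k\times k,2})^{(2)}$ is a simple Jordan algebra, isomorphic to the Jordan algebra of symmetric $k\times k$ matrices over $\mathbb F$ with product $a\circ b=\frac12(ab+ba)$ (type $B$). -/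

import Mathlib

namespace ConformalMatrix

/-! ### Conformal algebras in component form -/

/-- The operations `∂` and `Y⁺(u,z) = ∑_{n ≥ 0} u_n z^{-n-1}` on a vector space `V`;
`C.mode n u v` is `u_n v`. -/
structure ConformalOps (F V : Type*) [Field F] [AddCommGroup V] [Module F V] where
  /-- the operator `∂` -/
  del : V →ₗ[F] V
  /-- the operators `(u, v) ↦ u_n v` -/
  mode : ℕ → V →ₗ[F] V →ₗ[F] V

section General

variable {F V : Type*} [Field F] [AddCommGroup V] [Module F V]

/-- The subspace `W`, with the restrictions of `∂` and `Y⁺(·,z)`, is a conformal algebra: `W` is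
closed under the operations, `Y⁺(u,z)v` is a polynomial in `z⁻¹` without constant term, and the
following three identities, written out in coefficients, hold for elements of `W`:
* `Y⁺(∂u,z) = d/dz Y⁺(u,z)`,
* `Y⁺(u,z)v = Res_x e^{x∂} Y⁺(v,-x)u / (z-x)`,
* `[Y⁺(u,z₁), Y⁺(v,z₂)] = Res_x Y⁺(Y⁺(u,z₁-x)v,x) / (z₂-x)`. -/
structure IsConformalAlgebra (C : ConformalOps F V) (W : Submodule F V) : Prop where
  del_mem : ∀ u ∈ W, C.del u ∈ W
  mode_mem : ∀ n, ∀ u ∈ W, ∀ v ∈ W, C.mode n u v ∈ W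
  eventually_zero : ∀ u ∈ W, ∀ v ∈ W, ∃ N, ∀ n, N ≤ n → C.mode n u v = 0
  del_zero : ∀ u ∈ W, ∀ v ∈ W, C.mode 0 (C.del u) v = 0
  del_succ : ∀ n : ℕ, ∀ u ∈ W, ∀ v ∈ W,
    C.mode (n + 1) (C.del u) v = -((n + 1 : F) • C.mode n u v)
  skew : ∀ n N : ℕ, ∀ u ∈ W, ∀ v ∈ W, (∀ m, N ≤ m → C.mode m v u = 0) →
    C.mode n u v = ∑ j ∈ Finset.range N,
      ((-1 : F) ^ (n + j + 1) * ((j.factorial : F))⁻¹) • (C.del ^ j) (C.mode (n + j) v u)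
  commutator : ∀ m n : ℕ, ∀ u ∈ W, ∀ v ∈ W, ∀ w ∈ W,
    C.mode m u (C.mode n v w) - C.mode n v (C.mode m u w) =
      ∑ j ∈ Finset.range (m + 1), (m.choose j : F) • C.mode (m + n - j) (C.mode j u v) w

/-- `I` is an ideal of the conformal algebra `W`. -/
structure IsIdeal (C : ConformalOps F V) (W I : Submodule F V) : Prop where
  le : I ≤ W
  del_mem : ∀ x ∈ I, C.del x ∈ I
  mode_mem : ∀ n, ∀ u ∈ W, ∀ x ∈ I, C.mode n u x ∈ I

/-- The conformal algebra `W` is simple: it is nonzero, and its only ideals are `0` and `W`. -/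
def IsSimpleConformal (C : ConformalOps F V) (W : Submodule F V) : Prop :=
  W ≠ ⊥ ∧ ∀ I : Submodule F V, IsIdeal C W I → I = ⊥ ∨ I = W

/-- `span {u¹_{m₁} ⋯ uᵖ_{m_p} v ∣ uʲ, v ∈ S, p, mⱼ ∈ ℕ}`, the subspace generated by `S`. -/
def generatedBy (C : ConformalOps F V) (S : Set V) : Submodule F V :=
  Submodule.span F {x | ∃ L : List (V × ℕ), (∀ a ∈ L, a.1 ∈ S) ∧ ∃ v ∈ S,
    x = L.foldr (fun a w => C.mode a.2 a.1 w) v}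

/-- The bilinear operation `mul` makes the subspace `W` a simple (commutative) Jordan algebra. -/
structure IsSimpleJordan (mul : V →ₗ[F] V →ₗ[F] V) (W : Submodule F V) : Prop where
  mul_mem : ∀ x ∈ W, ∀ y ∈ W, mul x y ∈ W
  comm : ∀ x ∈ W, ∀ y ∈ W, mul x y = mul y x
  jordan : ∀ x ∈ W, ∀ y ∈ W, mul (mul x y) (mul x x) = mul x (mul y (mul x x))
  mul_ne_zero : ∃ x ∈ W, ∃ y ∈ W, mul x y ≠ 0
  ideals : ∀ J : Submodule F V, J ≤ W → (∀ x ∈ W, ∀ y ∈ J, mul x y ∈ J) → J = ⊥ ∨ J = W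

end General

/-! ### The conformal algebra `R(A)` for a purely even algebra `A` -/

/-- `R(A) = N(A) ⊗ F[t₁,t₂]` for an algebra `A = A₀` with `A₁ = 0`. Then `N(A)` consists of the
diagonal `2 × 2` matrices over `A`; an element is a finite family of coefficients in `A`, where
`(i, m, n)` indexes the `(i,i)`-entry and the monomial `t₁ᵐ t₂ⁿ`. -/
abbrev RA (A : Type*) [Ring A] : Type _ := (Fin 2 × ℕ × ℕ) →₀ A

section RA

variable (F : Type*) {A : Type*} [Field F] [Ring A] [Algebra F A]

/-- The element `u_{[i,i]}(m,n)`. -/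
noncomputable def elt (i : Fin 2) (m n : ℕ) (u : A) : RA A := Finsupp.single (i, m, n) u

/-- The Kronecker symbol `δ_{i,0}`. -/
def delta0 (i : Fin 2) : ℕ := if i = 0 then 1 else 0

/-- `∂ u_{[i,i]}(m,n) = (m+1) u_{[i,i]}(m+1,n) + (n+1) u_{[i,i]}(m,n+1)`. -/
noncomputable def raDel : RA A →ₗ[F] RA A :=
  Finsupp.lsum F fun a =>
    (a.2.1 + 1 : F) • Finsupp.lsingle (a.1, a.2.1 + 1, a.2.2) +
    (a.2.2 + 1 : F) • Finsupp.lsingle (a.1, a.2.1, a.2.2 + 1)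

/-- The coefficient of `z^{-r-1}` in
`Y⁺(u_{[i,i]}(m₁,m₂),z) v_{[j,j]}(n₁,n₂)`, as a bilinear map in `u, v`, where the two families of
terms of `Y⁺` are, with `δ = δ_{i,0}`,
`δ_{i,j} (n₁ δ + 1) binom(-n₁-1-δ, m₂)
  ∑_{p=0}^{m₁+m₂+n₁+δ} binom(p, m₁) (uv)_{[i,i]}(p,n₂) z^{p-m₁-m₂-n₁-1-δ}` and
`-δ_{i,j} (δ_{i,1} - (n₂+1) δ) binom(-n₂-1-δ, m₁)
  ∑_{q=0}^{m₁+m₂+n₂+δ} binom(q, m₂) (vu)_{[i,i]}(n₁,q) z^{q-m₁-m₂-n₂-1-δ}`. -/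
noncomputable def raTerm (r : ℕ) (a b : Fin 2 × ℕ × ℕ) : A →ₗ[F] A →ₗ[F] RA A :=
  let i := a.1
  let j := b.1
  let m₁ := a.2.1
  let m₂ := a.2.2
  let n₁ := b.2.1
  let n₂ := b.2.2
  let d := delta0 i
  (if i = j ∧ r ≤ m₁ + m₂ + n₁ + d then
    (((n₁ * d + 1 : ℤ) * Ring.choose (-n₁ - 1 - d : ℤ) m₂
        * (Nat.choose (m₁ + m₂ + n₁ + d - r) m₁ : ℤ) : ℤ) : F) •
      (LinearMap.mul F A).compr₂ (Finsupp.lsingle (i, m₁ + m₂ + n₁ + d - r, n₂))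
   else 0) -
  (if i = j ∧ r ≤ m₁ + m₂ + n₂ + d then
    ((((1 - d : ℤ) - (n₂ + 1) * d) * Ring.choose (-n₂ - 1 - d : ℤ) m₁
        * (Nat.choose (m₁ + m₂ + n₂ + d - r) m₂ : ℤ) : ℤ) : F) •
      (LinearMap.mul F A).flip.compr₂ (Finsupp.lsingle (i, n₁, m₁ + m₂ + n₂ + d - r))
   else 0)

/-- The operations of the conformal algebra `R(A)`. -/
noncomputable def raOps (A : Type*) [Ring A] [Algebra F A] : ConformalOps F (RA A) where
  del := raDel F
  mode r := Finsupp.lsum F fun a => LinearMap.flip (Finsupp.lsum F fun b => (raTerm F r a b).flip)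

theorem raDel_elt (i : Fin 2) (m n : ℕ) (u : A) :
    (raOps F A).del (elt i m n u) =
      (m + 1 : F) • elt i (m + 1) n u + (n + 1 : F) • elt i m (n + 1) u := by
  simp [raOps, raDel, elt]

theorem raMode_elt (r : ℕ) (i j : Fin 2) (m₁ m₂ n₁ n₂ : ℕ) (u v : A) :
    (raOps F A).mode r (elt i m₁ m₂ u) (elt j n₁ n₂ v) =
      raTerm F r (i, m₁, m₂) (j, n₁, n₂) u v := by
  simp [raOps, elt]

/-- The subspace of weight `n` of `R(A)`, spanned by the `u_{[i,i]}(m₁,m₂)` with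
`m₁ + m₂ + 2 δ_{i,0} + δ_{i,1} = n`. -/
noncomputable def weightSpace (A : Type*) [Ring A] [Algebra F A] (n : ℕ) : Submodule F (RA A) :=
  Submodule.span F {x | ∃ (i : Fin 2) (m₁ m₂ : ℕ) (u : A),
    m₁ + m₂ + (1 + delta0 i) = n ∧ x = elt i m₁ m₂ u}

/-- `R(A)^σ`, spanned by the `u_{[i,i]}(m,n) + (-1)^i σ(u)_{[i,i]}(n,m)`. -/
noncomputable def RSigma (σ : A → A) : Submodule F (RA A) :=
  Submodule.span F {x | ∃ (i : Fin 2) (m n : ℕ) (u : A),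
    x = elt i m n u + (-1 : F) ^ (i : ℕ) • elt i n m (σ u)}

end RA

/-! ### The two subalgebras attached to the transpose of matrices -/

section Matrices

variable (F : Type*) [Field F] (k : ℕ)

/-- The algebra of `k × k` matrices. -/
abbrev Mat : Type _ := Matrix (Fin k) (Fin k) F

/-- The matrix unit `E_{p,q}`. -/
def unitMat (p q : Fin k) : Mat F k := Matrix.single p q 1

/-- `R^*_{k×k,1}`. -/
noncomputable def RStar1 : Submodule F (RA (Mat F k)) :=
  Submodule.span F {x | ∃ (p q : Fin k) (m n : ℕ),
    x = elt 1 m n (unitMat F k p q) - elt 1 n m (unitMat F k q p)}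

/-- `R^*_{k×k,2}`. -/
noncomputable def RStar2 : Submodule F (RA (Mat F k)) :=
  Submodule.span F {x | ∃ (p q : Fin k) (m n : ℕ),
    x = elt 0 m n (unitMat F k p q) + elt 0 n m (unitMat F k q p)}

/-- The subspace of weight 2 of `R^*_{k×k,1}`. -/
noncomputable def RStar1Two : Submodule F (RA (Mat F k)) := RStar1 F k ⊓ weightSpace F (Mat F k) 2

/-- The subspace of weight 2 of `R^*_{k×k,2}`. -/
noncomputable def RStar2Two : Submodule F (RA (Mat F k)) := RStar2 F k ⊓ weightSpace F (Mat F k) 2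

/-- The space of symmetric `k × k` matrices. -/
def SymMat : Submodule F (Mat F k) where
  carrier := {a | a.transpose = a}
  add_mem' := by
    intro a b ha hb
    simp only [Set.mem_ofPred_eq] at ha hb ⊢
    rw [Matrix.transpose_add, ha, hb]
  zero_mem' := by simp
  smul_mem' := by
    intro c a ha
    simp only [Set.mem_ofPred_eq] at ha ⊢
    rw [Matrix.transpose_smul, ha]

/-- The product `a ∘ b = (ab + ba)/2` of the Jordan algebra of symmetric matrices (type B). -/
def symMul (a b : SymMat F k) : SymMat F k :=
  ⟨(2⁻¹ : F) • ((a : Mat F k) * b + (b : Mat F k) * a), by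
    have ha : (a : Mat F k).transpose = a := a.2
    have hb : (b : Mat F k).transpose = b := b.2
    change Matrix.transpose _ = _
    rw [Matrix.transpose_smul, Matrix.transpose_add, Matrix.transpose_mul, Matrix.transpose_mul,
      ha, hb, add_comm]⟩

end Matrices

end ConformalMatrix

/-! Encode `m! n! u_{[i,i]}(m,n)` as the `A`-valued polynomial `u xᵐ yⁿ` in the `i`-th component.
Then `∂` is multiplication by `x + y`, the binomial structure constants become falling factorials,
and with `δ = δ_{i,0}` all products are packed into `∑ tʳ/r! u_r v = (x+t)^δ u(x,-(x+t)) v(x+t,y) -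
(-(y+t))^δ v(x,y+t) u(-(y+t),y)`, which is `ev_generating`. Polynomials over an infinite field are
determined by their values, so every conformal algebra axiom becomes an identity between such
expressions, valid for any associative `A` (`mode_del`, `mode_skew`, `mode_commutator`). A subspace
then only has to be closed under the operations.

Both spaces of the theorem are spanned by symmetrizations `sy i m n a` of `a xᵐ yⁿ` under `a(x,y) ↦
(-1)ⁱ a(y,x)ᵗ`, and are treated together as `RStar F k i`. Closure is `mode_sy`.

Simplicity: in a nonzero ideal, a product of the highest order with `a x^M y^(M+1)` extracts the top
coefficient in `x` of an element, a polynomial `h(y)`; a second such product extracts the leading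
coefficient of `h`. Matrix units turn this nonzero matrix into all matrices, so the ideal is
everything (`IsIdeal.exists_row`, `IsIdeal.sy_mem_of_ne_bot`).

Generation: by the commutator formula the span of iterated products is closed under all products.
For `k > 1`, weight-two elements at `E_pp` multiply off-diagonal monomials by `2x`, and `E_pq E_qp =
E_pp` supplies the diagonal. For `k = 1`, the weight-two element gives only `2∂`, which leaves at
most one new class in each degree; the second generator removes it.

Weight two for `i = 0` is the space of symmetric matrices with `u_1 v = uv + vu`; simplicity comes
from Peirce-type computations with matrix units (`symMat_le_of_anticommutator_mem`). -/

namespace ConformalMatrix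

/-! ### Monomials -/

section Monomials

variable {F A V : Type*} [Field F] [Ring A] [Algebra F A] [AddCommGroup V] [Module F V]

variable (F) in
/-- The element `m! n! u_{[i,i]}(m,n)`, which corresponds to the polynomial `u xᵐ yⁿ`. -/
noncomputable def mon (i : Fin 2) (m n : ℕ) : A →ₗ[F] RA A :=
  ((m.factorial : F) * (n.factorial : F)) • Finsupp.lsingle (i, m, n)

theorem mon_eq (i : Fin 2) (m n : ℕ) (a : A) :
    mon F i m n a = ((m.factorial : F) * (n.factorial : F)) • elt i m n a := rfl

theorem delta0_le_one (i : Fin 2) : delta0 i ≤ 1 := by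
  unfold delta0; split <;> simp

theorem del_mon (i : Fin 2) (m n : ℕ) (a : A) :
    (raOps F A).del (mon F i m n a) = mon F i (m + 1) n a + mon F i m (n + 1) a := by
  rw [mon_eq, map_smul, raDel_elt, mon_eq, mon_eq, smul_add, smul_smul, smul_smul]
  congr 2 <;> · push_cast [Nat.factorial_succ]; ring

/-- The scalar identity that turns the binomial structure constants into falling factorials. -/
theorem structure_constant {d : ℕ} (hd : d ≤ 1) (m₁ m₂ n r : ℕ) (hr : r ≤ m₁ + m₂ + n + d) :
    ((m₁.factorial * m₂.factorial * n.factorial : ℤ) * ((n * d + 1 : ℤ) *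
      Ring.choose (-n - 1 - d : ℤ) m₂ * (Nat.choose (m₁ + m₂ + n + d - r) m₁ : ℤ))) =
    (-1) ^ m₂ * ((m₂ + n + d).descFactorial r : ℤ) * ((m₁ + m₂ + n + d - r).factorial : ℤ) := by
  have h1 : Ring.choose (-n - 1 - d : ℤ) m₂ = (-1) ^ m₂ * ((m₂ + n + d).choose m₂ : ℤ) := by
    have : (-n - 1 - d : ℤ) = -((n + d + 1 : ℕ) : ℤ) := by push_cast; ring
    rw [this, Ring.choose_neg]
    have h2 : (((n + d + 1 : ℕ) : ℤ) + (m₂ : ℤ) - 1) = ((m₂ + n + d : ℕ) : ℤ) := by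
      push_cast; ring
    rw [h2, Ring.choose_natCast, Int.negOnePow_def]
    simp [Units.smul_def]
  -- This is where `d ≤ 1` is needed: the factor `n * d + 1` extends `n!` to `(n + d)!`.
  have h2 : (n.factorial * (n * d + 1) : ℤ) = ((n + d).factorial : ℤ) := by
    interval_cases d
    · simp
    · push_cast [Nat.factorial_succ]; ring
  have h3 : ((m₂ + n + d).choose m₂ * m₂.factorial * (n + d).factorial : ℤ) =
      ((m₂ + n + d).factorial : ℤ) := by
    have := Nat.choose_mul_factorial_mul_factorial (Nat.le_add_right m₂ (n + d))
    rw [Nat.add_sub_cancel_left, ← add_assoc] at this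
    exact_mod_cast this
  have h4 : ((m₂ + n + d).factorial * m₁.factorial * (m₁ + m₂ + n + d - r).choose m₁ : ℤ) =
      ((m₂ + n + d).descFactorial r : ℤ) * ((m₁ + m₂ + n + d - r).factorial : ℤ) := by
    rcases le_or_gt r (m₂ + n + d) with h | h
    · obtain ⟨s, hs⟩ := Nat.exists_eq_add_of_le h
      have e : m₁ + m₂ + n + d - r = m₁ + s := by omega
      have h5 := Nat.factorial_mul_descFactorial h
      have h6 := Nat.choose_mul_factorial_mul_factorial (Nat.le_add_right m₁ s)
      have e' : m₂ + n + d - r = s := by omega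
      rw [e'] at h5
      rw [Nat.add_sub_cancel_left] at h6
      rw [e, ← h5, ← h6]
      push_cast; ring
    · rw [Nat.choose_eq_zero_of_lt (by omega), Nat.descFactorial_of_lt h]; simp
  rw [h1]
  linear_combination ((-1) ^ m₂ * (m₁.factorial : ℤ) * m₂.factorial *
    ((m₂ + n + d).choose m₂ : ℤ) * ((m₁ + m₂ + n + d - r).choose m₁ : ℤ)) * h2 +
    ((-1) ^ m₂ * (m₁.factorial : ℤ) * ((m₁ + m₂ + n + d - r).choose m₁ : ℤ)) * h3 + (-1) ^ m₂ * h4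

theorem mode_mon_ne (r : ℕ) {i j : Fin 2} (hij : i ≠ j) (m₁ m₂ n₁ n₂ : ℕ) (a b : A) :
    (raOps F A).mode r (mon F i m₁ m₂ a) (mon F j n₁ n₂ b) = 0 := by
  simp [mon_eq, raMode_elt, raTerm, hij]

/-- The range conditions on `r` disappear because `descFactorial` vanishes beyond them; for the same
reason the truncated subtraction in the exponents is harmless. -/
theorem mode_mon (r : ℕ) (i : Fin 2) (m₁ m₂ n₁ n₂ : ℕ) (a b : A) :
    (raOps F A).mode r (mon F i m₁ m₂ a) (mon F i n₁ n₂ b) =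
      ((-1) ^ m₂ * ((m₂ + n₁ + delta0 i).descFactorial r : F)) •
        mon F i (m₁ + m₂ + n₁ + delta0 i - r) n₂ (a * b) -
      ((-1) ^ (m₁ + delta0 i) * ((m₁ + n₂ + delta0 i).descFactorial r : F)) •
        mon F i n₁ (m₁ + m₂ + n₂ + delta0 i - r) (b * a) := by
  have hd := delta0_le_one i
  rw [mon_eq, mon_eq, map_smul, map_smul, LinearMap.smul_apply, raMode_elt]
  simp only [raTerm, true_and]
  generalize delta0 i = d at *
  rw [LinearMap.sub_apply, LinearMap.sub_apply, smul_sub, smul_sub]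
  congr 1
  · split_ifs with h
    · have := congrArg (Int.cast : ℤ → F) (structure_constant hd m₁ m₂ n₁ r h)
      simp only [LinearMap.smul_apply, LinearMap.compr₂_apply, mon_eq, smul_smul]
      change _ • elt _ _ _ _ = _
      congr 1
      push_cast at this ⊢
      linear_combination (n₂.factorial : F) * this
    · rw [Nat.descFactorial_of_lt (by omega)]; simp
  · split_ifs with h
    -- The second family is the first with `m₁, m₂` exchanged and `n₂` in place of `n₁`, up to the
    -- sign `(-1)^d` of `hs`.
    · have := congrArg (Int.cast : ℤ → F) (structure_constant hd m₂ m₁ n₂ r (by omega))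
      simp only [LinearMap.smul_apply, LinearMap.compr₂_apply, mon_eq, smul_smul]
      change _ • elt _ _ _ _ = _
      congr 1
      rw [add_comm m₂ m₁] at this
      have hs : ((1 - d : F) - (n₂ + 1) * d) = (-1) ^ d * (n₂ * d + 1) := by
        interval_cases d
        · simp
        · simp
      push_cast at this ⊢
      rw [hs, pow_add]
      linear_combination ((-1) ^ d * n₁.factorial : F) * this
    · rw [Nat.descFactorial_of_lt (by omega)]; simp

variable [CharZero F]

theorem elt_eq_mon (i : Fin 2) (m n : ℕ) (a : A) :
    elt i m n a = ((m.factorial : F) * (n.factorial : F))⁻¹ • mon F i m n a := by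
  rw [mon_eq, smul_smul, inv_mul_cancel₀, one_smul]
  exact mul_ne_zero (Nat.cast_ne_zero.2 m.factorial_ne_zero) (Nat.cast_ne_zero.2 n.factorial_ne_zero)

variable (F) in
theorem mon_induction {p : RA A → Prop} (zero : p 0) (add : ∀ u v, p u → p v → p (u + v))
    (mon : ∀ i m n a, p (mon F i m n a)) (u : RA A) : p u := by
  induction u using Finsupp.induction_linear with
  | zero => exact zero
  | add f g hf hg => exact add f g hf hg
  | single t a =>
    obtain ⟨i, m, n⟩ := t
    change p (elt i m n a)
    rw [elt_eq_mon (F := F), ← map_smul]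
    exact mon _ _ _ _

variable (F) in
theorem mode_eventually_zero (u v : RA A) : ∃ N, ∀ r, N ≤ r → (raOps F A).mode r u v = 0 := by
  induction u using mon_induction F (A := A) with
  | zero => exact ⟨0, by simp⟩
  | add u u' hu hu' =>
    obtain ⟨N, hN⟩ := hu
    obtain ⟨N', hN'⟩ := hu'
    refine ⟨max N N', fun r hr => ?_⟩
    rw [map_add, LinearMap.add_apply, hN r (le_of_max_le_left hr), hN' r (le_of_max_le_right hr),
      add_zero]
  | mon i m₁ m₂ a =>
    induction v using mon_induction F (A := A) with
    | zero => exact ⟨0, by simp⟩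
    | add v v' hv hv' =>
      obtain ⟨N, hN⟩ := hv
      obtain ⟨N', hN'⟩ := hv'
      refine ⟨max N N', fun r hr => ?_⟩
      rw [map_add, hN r (le_of_max_le_left hr), hN' r (le_of_max_le_right hr), add_zero]
    | mon j n₁ n₂ b =>
      by_cases hij : i = j
      · subst hij
        refine ⟨m₁ + m₂ + n₁ + n₂ + delta0 i + 1, fun r hr => ?_⟩
        rw [mode_mon, Nat.descFactorial_of_lt (by omega), Nat.descFactorial_of_lt (by omega)]
        simp
      · exact ⟨0, fun r _ => mode_mon_ne r hij _ _ _ _ _ _⟩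

/-! ### Evaluation of the associated polynomials -/

/-- A polynomial function with coefficients in a vector space over an infinite field determines
its coefficients. -/
theorem eq_zero_of_sum_pow_smul_eq_zero {N : ℕ} {a : ℕ → V}
    (h : ∀ t : F, ∑ n ∈ Finset.range N, t ^ n • a n = 0) : ∀ n < N, a n = 0 := by
  intro n hn
  -- A linear functional reduces the claim to a scalar polynomial that vanishes on all of the
  -- infinite field `F`.
  rw [← Module.forall_dual_apply_eq_zero_iff F]
  intro φ
  let p : Polynomial F := ∑ n ∈ Finset.range N, Polynomial.monomial n (φ (a n))
  have hp : p = 0 := by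
    refine Polynomial.funext fun t => ?_
    have := congrArg φ (h t)
    simp only [map_sum, map_smul, map_zero, smul_eq_mul] at this
    simp only [p, Polynomial.eval_finsetSum, Polynomial.eval_monomial, Polynomial.eval_zero]
    rw [← this]
    exact Finset.sum_congr rfl fun n _ => mul_comm _ _
  have := congrArg (fun q => Polynomial.coeff q n) hp
  simpa [p, Polynomial.finsetSum_coeff, Polynomial.coeff_monomial, hn] using this

/-- The value at `(x, y)` of the polynomial `∑ a_{m,n} xᵐ yⁿ` attached to the `i`-th component
`∑ m! n! (a_{m,n})_{[i,i]}(m,n)`. -/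
noncomputable def ev (i : Fin 2) (x y : F) : RA A →ₗ[F] A :=
  Finsupp.lsum F fun t => if t.1 = i then
    (x ^ t.2.1 * y ^ t.2.2 * ((t.2.1.factorial : F) * (t.2.2.factorial : F))⁻¹) • LinearMap.id else 0

theorem ev_mon (i j : Fin 2) (x y : F) (m n : ℕ) (a : A) :
    ev i x y (mon F j m n a) = if j = i then (x ^ m * y ^ n) • a else 0 := by
  have h : ((m.factorial : F) * (n.factorial : F)) ≠ 0 :=
    mul_ne_zero (Nat.cast_ne_zero.2 m.factorial_ne_zero) (Nat.cast_ne_zero.2 n.factorial_ne_zero)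
  simp only [mon_eq, elt, ev, map_smul, Finsupp.lsum_single]
  split_ifs with hij
  · simp only [LinearMap.smul_apply, LinearMap.id_apply, smul_smul]
    congr 1
    rw [mul_comm, mul_assoc, inv_mul_cancel₀ h, mul_one]
  · simp

theorem eq_zero_of_ev_eq_zero {w : RA A} (h : ∀ (i : Fin 2) (x y : F), ev i x y w = 0) : w = 0 := by
  obtain ⟨N, hN⟩ : ∃ N, ∀ t ∈ w.support, t.2.1 < N ∧ t.2.2 < N := by
    refine ⟨(w.support.sup fun t => t.2.1 + t.2.2) + 1, fun t ht => ?_⟩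
    have := Finset.le_sup (f := fun t : Fin 2 × ℕ × ℕ => t.2.1 + t.2.2) ht
    exact ⟨by omega, by omega⟩
  have hev : ∀ (i : Fin 2) (x y : F), ev i x y w = ∑ m ∈ Finset.range N, x ^ m •
      ∑ n ∈ Finset.range N, y ^ n • (((m.factorial : F) * (n.factorial : F))⁻¹ • w (i, m, n)) := by
    intro i x y
    have hs : w.support ⊆ (Finset.univ : Finset (Fin 2)) ×ˢ Finset.range N ×ˢ Finset.range N := by
      intro t ht
      simp [hN t ht]
    rw [ev, Finsupp.lsum_apply, Finsupp.sum_of_support_subset _ hs _ (by simp),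
      Finset.sum_product, Finset.sum_eq_single i]
    · rw [Finset.sum_product]
      refine Finset.sum_congr rfl fun m _ => ?_
      rw [Finset.smul_sum]
      refine Finset.sum_congr rfl fun n _ => ?_
      simp [smul_smul, mul_assoc]
    · intro j _ hj
      simp [hj]
    · simp
  ext ⟨i, m, n⟩
  by_contra hne
  obtain ⟨hm, hn⟩ := hN (i, m, n) (Finsupp.mem_support_iff.2 hne)
  -- For fixed `y`, varying `x` isolates the coefficient of `xᵐ`; varying `y` then isolates that of
  -- `yⁿ`.
  have h1 := eq_zero_of_sum_pow_smul_eq_zero (F := F) (N := N) (fun y =>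
    eq_zero_of_sum_pow_smul_eq_zero (fun x => (hev i x y).symm.trans (h i x y)) m hm) n hn
  rw [smul_eq_zero, inv_eq_zero, mul_eq_zero] at h1
  rcases h1 with (h1 | h1) | h1
  · exact Nat.cast_ne_zero.2 m.factorial_ne_zero h1
  · exact Nat.cast_ne_zero.2 n.factorial_ne_zero h1
  · exact hne h1

theorem ev_injective {v w : RA A} (h : ∀ (i : Fin 2) (x y : F), ev i x y v = ev i x y w) : v = w :=
  sub_eq_zero.1 (eq_zero_of_ev_eq_zero (F := F) fun i x y => by rw [map_sub, h, sub_self])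

theorem ev_del (i : Fin 2) (x y : F) (u : RA A) :
    ev i x y ((raOps F A).del u) = (x + y) • ev i x y u := by
  induction u using mon_induction F (A := A) with
  | zero => simp
  | add u v hu hv => rw [map_add, map_add, map_add, hu, hv, smul_add]
  | mon j m n a =>
    rw [del_mon, map_add, ev_mon, ev_mon, ev_mon]
    split_ifs
    · rw [smul_smul, ← add_smul]; congr 1; ring
    · simp

/-- The binomial expansion of `(x + t)ˢ` in divided powers of `t`. -/
theorem sum_descFactorial (x t : F) (m s N : ℕ) (hN : s < N) :
    ∑ r ∈ Finset.range N, (t ^ r * (r.factorial : F)⁻¹) * (s.descFactorial r * x ^ (m + s - r)) =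
      x ^ m * (x + t) ^ s := by
  rw [← Finset.sum_subset (Finset.range_subset_range.2 hN), add_comm x t, add_pow, Finset.mul_sum]
  · refine Finset.sum_congr rfl fun r hr => ?_
    have hr' : r ≤ s := Nat.lt_succ_iff.1 (Finset.mem_range.1 hr)
    have h0 : (r.factorial : F) ≠ 0 := Nat.cast_ne_zero.2 r.factorial_ne_zero
    rw [Nat.descFactorial_eq_factorial_mul_choose, Nat.add_sub_assoc hr', pow_add]
    push_cast
    field_simp
  · intro r _ hr
    rw [Nat.descFactorial_of_lt (by simpa using hr)]
    simp

/-- The generating function `∑ tʳ/r! u_r v`, for all large truncations of the sum. -/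
theorem ev_generating (u v : RA A) : ∃ N₀, ∀ N, N₀ ≤ N → ∀ (i : Fin 2) (t x y : F),
    ∑ r ∈ Finset.range N, (t ^ r * (r.factorial : F)⁻¹) • ev i x y ((raOps F A).mode r u v) =
      (x + t) ^ delta0 i • (ev i x (-(x + t)) u * ev i (x + t) y v) -
      (-(y + t)) ^ delta0 i • (ev i x (y + t) v * ev i (-(y + t)) y u) := by
  induction u using mon_induction F (A := A) with
  | zero => exact ⟨0, by simp⟩
  | add u u' hu hu' =>
    obtain ⟨N, hN⟩ := hu
    obtain ⟨N', hN'⟩ := hu'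
    refine ⟨max N N', fun M hM i t x y => ?_⟩
    simp only [map_add, LinearMap.add_apply, smul_add, Finset.sum_add_distrib, mul_add, add_mul,
      hN M (le_of_max_le_left hM) i t x y, hN' M (le_of_max_le_right hM) i t x y]
    abel
  | mon j m₁ m₂ a =>
    induction v using mon_induction F (A := A) with
    | zero => exact ⟨0, by simp⟩
    | add v v' hv hv' =>
      obtain ⟨N, hN⟩ := hv
      obtain ⟨N', hN'⟩ := hv'
      refine ⟨max N N', fun M hM i t x y => ?_⟩
      simp only [map_add, smul_add, Finset.sum_add_distrib, mul_add, add_mul,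
        hN M (le_of_max_le_left hM) i t x y, hN' M (le_of_max_le_right hM) i t x y]
      abel
    | mon l n₁ n₂ b =>
      by_cases hjl : j = l
      · subst hjl
        refine ⟨m₁ + m₂ + n₁ + n₂ + delta0 j + 1, fun N hN i t x y => ?_⟩
        by_cases hji : j = i
        · subst hji
          simp only [mode_mon, map_sub, map_smul, ev_mon, if_true, smul_sub, Finset.sum_sub_distrib,
            smul_smul, ← Finset.sum_smul, smul_mul_smul_comm]
          congr 2
          · have := sum_descFactorial x t m₁ (m₂ + n₁ + delta0 j) N (by omega)
            rw [neg_pow (x + t)]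
            simp only [← add_assoc] at this
            rw [show (x + t) ^ delta0 j * (x ^ m₁ * ((-1) ^ m₂ * (x + t) ^ m₂) *
              ((x + t) ^ n₁ * y ^ n₂)) = (-1) ^ m₂ * y ^ n₂ *
                (x ^ m₁ * (x + t) ^ (m₂ + n₁ + delta0 j)) by rw [pow_add, pow_add]; ring,
              ← this, Finset.mul_sum]
            exact Finset.sum_congr rfl fun r _ => by ring
          · have := sum_descFactorial y t m₂ (m₁ + n₂ + delta0 j) N (by omega)
            rw [neg_pow (y + t), neg_pow (y + t) m₁]
            simp only [← add_assoc, add_comm m₂ m₁] at this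
            rw [show (-1) ^ delta0 j * (y + t) ^ delta0 j * (x ^ n₁ * (y + t) ^ n₂ *
              ((-1) ^ m₁ * (y + t) ^ m₁ * y ^ m₂)) = (-1) ^ (m₁ + delta0 j) * x ^ n₁ *
                (y ^ m₂ * (y + t) ^ (m₁ + n₂ + delta0 j)) by rw [pow_add, pow_add, pow_add]; ring,
              ← this, Finset.mul_sum]
            exact Finset.sum_congr rfl fun r _ => by ring
        · simp [mode_mon, ev_mon, hji]
      · refine ⟨0, fun N _ i t x y => ?_⟩
        have : ¬ (j = i ∧ l = i) := fun h => hjl (h.1.trans h.2.symm)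
        simp only [mode_mon_ne _ hjl, ev_mon]
        by_cases hji : j = i
        · simp [hji, show l ≠ i from fun h => this ⟨hji, h⟩]
        · simp [hji]

end Monomials

/-! ### The conformal algebra axioms for `R(A)` -/

section Axioms

variable {F A V : Type*} [Field F] [Ring A] [Algebra F A] [AddCommGroup V] [Module F V] [CharZero F]

theorem add_pow_div_factorial_eq_sum (α β : F) (s : ℕ) :
    (α + β) ^ s * (s.factorial : F)⁻¹ = ∑ p ∈ Finset.HasAntidiagonal.antidiagonal s,
      (α ^ p.1 * (p.1.factorial : F)⁻¹) * (β ^ p.2 * (p.2.factorial : F)⁻¹) := by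
  rw [(Commute.all α β).add_pow', Finset.sum_mul]
  refine Finset.sum_congr rfl fun p hp => ?_
  rw [Finset.HasAntidiagonal.mem_antidiagonal] at hp
  subst hp
  have h1 : (p.1.factorial : F) ≠ 0 := Nat.cast_ne_zero.2 p.1.factorial_ne_zero
  have h2 : (p.2.factorial : F) ≠ 0 := Nat.cast_ne_zero.2 p.2.factorial_ne_zero
  have h3 : ((p.1 + p.2).factorial : F) ≠ 0 := Nat.cast_ne_zero.2 (Nat.factorial_ne_zero _)
  have h := Nat.choose_mul_factorial_mul_factorial (Nat.le_add_right p.1 p.2)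
  rw [Nat.add_sub_cancel_left] at h
  rw [nsmul_eq_mul]
  rw [← h] at h3 ⊢
  push_cast at h3 ⊢
  have h4 : ((p.1 + p.2).choose p.1 : F) ≠ 0 := fun h => h3 (by rw [h]; ring)
  field_simp

/-- The exponential law, for coefficients that vanish from some index on. -/
theorem sum_sum_eq_sum_add_pow {M : ℕ} {w : ℕ → V} (hw : ∀ s, M ≤ s → w s = 0) (α β : F) :
    ∑ n ∈ Finset.range M, ∑ j ∈ Finset.range M,
      ((α ^ n * (n.factorial : F)⁻¹) * (β ^ j * (j.factorial : F)⁻¹)) • w (n + j) =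
    ∑ s ∈ Finset.range M, ((α + β) ^ s * (s.factorial : F)⁻¹) • w s := by
  -- Pairs with `n + j ≥ M` contribute nothing; the others are grouped by `s = n + j`.
  rw [← Finset.sum_product', ← Finset.sum_filter_add_sum_filter_not _ (fun p : ℕ × ℕ => p.1 + p.2 < M),
    Finset.sum_eq_zero (s := Finset.filter (fun p : ℕ × ℕ => ¬ p.1 + p.2 < M) _), add_zero,
    ← Finset.sum_fiberwise_of_maps_to (t := Finset.range M) (g := fun p : ℕ × ℕ => p.1 + p.2)]
  · refine Finset.sum_congr rfl fun s hs => ?_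
    rw [add_pow_div_factorial_eq_sum, Finset.sum_smul]
    have : (Finset.filter (fun p : ℕ × ℕ => p.1 + p.2 = s) (Finset.filter (fun p => p.1 + p.2 < M)
        (Finset.range M ×ˢ Finset.range M))) = Finset.HasAntidiagonal.antidiagonal s := by
      ext p
      simp only [Finset.mem_filter, Finset.mem_product, Finset.mem_range,
        Finset.HasAntidiagonal.mem_antidiagonal] at hs ⊢
      omega
    rw [this]
    refine Finset.sum_congr rfl fun p hp => ?_
    rw [Finset.HasAntidiagonal.mem_antidiagonal.1 hp]
  · intro p hp
    simpa using (Finset.mem_filter.1 hp).2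
  · intro p hp
    rw [hw _ (not_lt.1 (Finset.mem_filter.1 hp).2), smul_zero]

/-- The exponential law for the right-hand side of the commutator formula. -/
theorem sum_sum_choose_smul {M N : ℕ} (hN : 2 * M ≤ N) {B : ℕ → ℕ → V}
    (hB : ∀ j s, M ≤ j → B j s = 0) (hB' : ∀ j s, M ≤ s → B j s = 0) (α β : F) :
    ∑ m ∈ Finset.range N, ∑ n ∈ Finset.range N,
      ((α ^ m * (m.factorial : F)⁻¹) * (β ^ n * (n.factorial : F)⁻¹)) •
        ∑ j ∈ Finset.range (m + 1), (m.choose j : F) • B j (m + n - j) =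
    ∑ j ∈ Finset.range N, (α ^ j * (j.factorial : F)⁻¹) •
      ∑ s ∈ Finset.range N, ((α + β) ^ s * (s.factorial : F)⁻¹) • B j s := by
  have h1 : ∀ m ∈ Finset.range N, ∑ n ∈ Finset.range N,
      ((α ^ m * (m.factorial : F)⁻¹) * (β ^ n * (n.factorial : F)⁻¹)) •
        ∑ j ∈ Finset.range (m + 1), (m.choose j : F) • B j (m + n - j) =
      ∑ j ∈ Finset.range (m + 1), (fun j a => (α ^ j * (j.factorial : F)⁻¹) •
        ∑ n ∈ Finset.range N, ((α ^ a * (a.factorial : F)⁻¹) * (β ^ n * (n.factorial : F)⁻¹)) •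
          B j (a + n)) j (m - j) := by
    intro m _
    simp only [Finset.smul_sum]
    rw [Finset.sum_comm]
    refine Finset.sum_congr rfl fun j hj => Finset.sum_congr rfl fun n _ => ?_
    have hj' : j ≤ m := Nat.lt_succ_iff.1 (Finset.mem_range.1 hj)
    obtain ⟨a, rfl⟩ := Nat.exists_eq_add_of_le hj'
    rw [Nat.add_sub_cancel_left, show j + a + n - j = a + n by omega, smul_smul, smul_smul]
    congr 1
    have h1 : (j.factorial : F) ≠ 0 := Nat.cast_ne_zero.2 j.factorial_ne_zero
    have h2 : (a.factorial : F) ≠ 0 := Nat.cast_ne_zero.2 a.factorial_ne_zero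
    have h3 : ((j + a).factorial : F) ≠ 0 := Nat.cast_ne_zero.2 (Nat.factorial_ne_zero _)
    have h := Nat.choose_mul_factorial_mul_factorial (Nat.le_add_right j a)
    rw [Nat.add_sub_cancel_left] at h
    rw [← h] at h3 ⊢
    push_cast at h3 ⊢
    have h4 : ((j + a).choose j : F) ≠ 0 := fun h => h3 (by rw [h]; ring)
    rw [pow_add]
    field_simp
  rw [Finset.sum_congr rfl h1, Finset.sum_range_diag_flip (f := fun j a =>
    (α ^ j * (j.factorial : F)⁻¹) • ∑ n ∈ Finset.range N,
      ((α ^ a * (a.factorial : F)⁻¹) * (β ^ n * (n.factorial : F)⁻¹)) • B j (a + n))]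
  refine Finset.sum_congr rfl fun j hj => ?_
  rw [← sum_sum_eq_sum_add_pow (fun s hs => hB' j s (by omega)), Finset.smul_sum]
  refine Finset.sum_subset (Finset.range_subset_range.2 (Nat.sub_le _ _)) fun a ha ha' => ?_
  rw [Finset.sum_eq_zero, smul_zero]
  intro n _
  rw [Finset.mem_range] at ha ha'
  -- The pairs lost to truncation have `j + a ≥ N ≥ 2 * M`, so one of the two indices of `B` is at
  -- least `M`.
  rcases le_or_gt M j with h | h
  · rw [hB _ _ h, smul_zero]
  · rw [hB' _ _ (by omega), smul_zero]

theorem eq_of_ev_sum_pow {N : ℕ} {a b : ℕ → RA A}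
    (h : ∀ (i : Fin 2) (x y t : F), ∑ n ∈ Finset.range N, t ^ n • ev i x y (a n) =
      ∑ n ∈ Finset.range N, t ^ n • ev i x y (b n)) : ∀ n < N, a n = b n := by
  intro n hn
  refine ev_injective (F := F) fun i x y => sub_eq_zero.1 ?_
  refine eq_zero_of_sum_pow_smul_eq_zero (F := F) (N := N)
    (a := fun n => ev i x y (a n) - ev i x y (b n)) (fun t => ?_) n hn
  simp only [smul_sub, Finset.sum_sub_distrib, h i x y t, sub_self]

-- `∂u` has values `(x + y) u(x,y)`, and the factor `x + y` equals `-t` both at `(x, -(x+t))` and at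
-- `(-(y+t), y)`. So passing from `u` to `∂u` multiplies the generating function by `-t`, which
-- shifts the coefficients by one.
variable (F) in
theorem mode_del (u v : RA A) : (raOps F A).mode 0 ((raOps F A).del u) v = 0 ∧
    ∀ n : ℕ, (raOps F A).mode (n + 1) ((raOps F A).del u) v =
      -((n + 1 : F) • (raOps F A).mode n u v) := by
  obtain ⟨N₁, h₁⟩ := ev_generating (F := F) u v
  obtain ⟨N₂, h₂⟩ := ev_generating (F := F) ((raOps F A).del u) v
  let b : ℕ → RA A := fun n => Nat.casesOn n 0 fun n =>
    -((n.factorial : F)⁻¹ • (raOps F A).mode n u v)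
  have key : ∀ n, (n.factorial : F)⁻¹ • (raOps F A).mode n ((raOps F A).del u) v = b n := by
    intro n
    refine eq_of_ev_sum_pow (F := F) (N := max N₁ (max N₂ n) + 1)
      (a := fun n => (n.factorial : F)⁻¹ • (raOps F A).mode n ((raOps F A).del u) v)
      (fun i x y t => ?_) n (by omega)
    have e₁ := h₁ (max N₁ (max N₂ n)) (by omega) i t x y
    have e₂ := h₂ (max N₁ (max N₂ n) + 1) (by omega) i t x y
    simp only [map_smul, smul_smul]
    rw [e₂, Finset.sum_range_succ']
    have : ∀ r ∈ Finset.range (max N₁ (max N₂ n)), t ^ (r + 1) • ev i x y (b (r + 1)) =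
        (-t) • (t ^ r * (r.factorial : F)⁻¹) • ev i x y ((raOps F A).mode r u v) := by
      intro r _
      simp only [b, map_neg, map_smul, smul_neg, smul_smul, neg_smul, neg_mul]
      rw [pow_succ']; congr 2; ring
    rw [Finset.sum_congr rfl this, ← Finset.smul_sum, e₁, ev_del, ev_del,
      show b 0 = 0 from rfl, map_zero, smul_zero, add_zero]
    simp only [smul_mul_assoc, mul_smul_comm]
    match_scalars <;> ring
  refine ⟨by simpa [b] using key 0, fun n => ?_⟩
  have h0 : ((n + 1).factorial : F) ≠ 0 := Nat.cast_ne_zero.2 (Nat.factorial_ne_zero _)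
  have h1 : (n.factorial : F) ≠ 0 := Nat.cast_ne_zero.2 (Nat.factorial_ne_zero _)
  have := congrArg (fun z => ((n + 1).factorial : F) • z) (key (n + 1))
  simp only [b, smul_smul, smul_neg, mul_inv_cancel₀ h0, one_smul] at this
  rw [this, Nat.factorial_succ]
  congr 2
  push_cast
  field_simp

theorem ev_del_pow (i : Fin 2) (x y : F) (j : ℕ) (u : RA A) :
    ev i x y (((raOps F A).del ^ j) u) = (x + y) ^ j • ev i x y u := by
  induction j with
  | zero => simp
  | succ j ih => rw [pow_succ', Module.End.mul_apply, ev_del, ih, smul_smul, pow_succ']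

/-- The substitution `t ↦ -t - (x + y)` exchanges `x + t` with `-(y + t)`, hence interchanges the
two terms of the generating function with a change of sign. The summand `-(x + y)` is the effect of
the powers of `∂`. -/
theorem mode_skew (n N : ℕ) (u v : RA A) (hN : ∀ m, N ≤ m → (raOps F A).mode m v u = 0) :
    (raOps F A).mode n u v = ∑ j ∈ Finset.range N,
      ((-1 : F) ^ (n + j + 1) * ((j.factorial : F))⁻¹) •
        ((raOps F A).del ^ j) ((raOps F A).mode (n + j) v u) := by
  obtain ⟨N₁, h₁⟩ := ev_generating (F := F) u v
  obtain ⟨N₂, h₂⟩ := ev_generating (F := F) v u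
  have h0 : (n.factorial : F) ≠ 0 := Nat.cast_ne_zero.2 (Nat.factorial_ne_zero _)
  set M := max N (max N₁ (max N₂ (n + 1))) with hM
  have key : (n.factorial : F)⁻¹ • (raOps F A).mode n u v = (n.factorial : F)⁻¹ •
      ∑ j ∈ Finset.range N, ((-1 : F) ^ (n + j + 1) * ((j.factorial : F))⁻¹) •
        ((raOps F A).del ^ j) ((raOps F A).mode (n + j) v u) := by
    refine eq_of_ev_sum_pow (F := F) (N := M)
      (a := fun n => (n.factorial : F)⁻¹ • (raOps F A).mode n u v)
      (b := fun n => (n.factorial : F)⁻¹ • ∑ j ∈ Finset.range N,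
        ((-1 : F) ^ (n + j + 1) * ((j.factorial : F))⁻¹) •
        ((raOps F A).del ^ j) ((raOps F A).mode (n + j) v u))
      (fun i x y t => ?_) n (by omega)
    have hs : ∀ r ∈ Finset.range M, t ^ r • ev i x y ((r.factorial : F)⁻¹ •
        ∑ j ∈ Finset.range N, ((-1 : F) ^ (r + j + 1) * ((j.factorial : F))⁻¹) •
        ((raOps F A).del ^ j) ((raOps F A).mode (r + j) v u)) =
        -∑ j ∈ Finset.range M, (((-t) ^ r * (r.factorial : F)⁻¹) *
          ((-(x + y)) ^ j * (j.factorial : F)⁻¹)) • ev i x y ((raOps F A).mode (r + j) v u) := by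
      intro r _
      rw [← Finset.sum_subset (Finset.range_subset_range.2 (show N ≤ M by omega)), map_smul,
        map_sum, smul_smul, Finset.smul_sum, ← Finset.sum_neg_distrib]
      · refine Finset.sum_congr rfl fun j _ => ?_
        rw [map_smul, ev_del_pow, smul_smul, smul_smul, ← neg_smul]
        congr 1
        rw [neg_pow t, neg_pow (x + y), pow_succ, pow_add]
        ring
      · intro j _ hj
        rw [hN _ (by rw [Finset.mem_range] at hj; omega), map_zero, smul_zero]
    have e₁ := h₁ M (by omega) i t x y
    have e₂ := h₂ M (by omega) i (-t + -(x + y)) x y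
    simp only [map_smul, smul_smul]
    rw [e₁]
    simp only [map_smul, smul_smul] at hs
    rw [Finset.sum_congr rfl hs, Finset.sum_neg_distrib, sum_sum_eq_sum_add_pow
      (w := fun s => ev i x y ((raOps F A).mode s v u))
      (fun s hs => by rw [hN s (by omega), map_zero]), e₂]
    rw [show x + (-t + -(x + y)) = -(y + t) by ring, show y + (-t + -(x + y)) = -(x + t) by ring,
      neg_neg, neg_neg]
    abel
  have := congrArg (fun z => (n.factorial : F) • z) key
  simpa only [smul_smul, mul_inv_cancel₀ h0, one_smul] using this

/-- The point is a truncation bound independent of `n`: only finitely many `v_n w` are nonzero. -/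
theorem ev_generating_mode (u v w : RA A) : ∃ N₀, ∀ N, N₀ ≤ N → ∀ (n : ℕ) (i : Fin 2) (t x y : F),
    ∑ r ∈ Finset.range N, (t ^ r * (r.factorial : F)⁻¹) •
        ev i x y ((raOps F A).mode r u ((raOps F A).mode n v w)) =
      (x + t) ^ delta0 i • (ev i x (-(x + t)) u * ev i (x + t) y ((raOps F A).mode n v w)) -
      (-(y + t)) ^ delta0 i •
        (ev i x (y + t) ((raOps F A).mode n v w) * ev i (-(y + t)) y u) := by
  obtain ⟨K, hK⟩ := mode_eventually_zero F v w
  choose f hf using fun n => ev_generating (F := F) u ((raOps F A).mode n v w)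
  refine ⟨(Finset.range K).sup f, fun N hN n => ?_⟩
  rcases lt_or_ge n K with h | h
  · exact hf n N ((Finset.le_sup (Finset.mem_range.2 h)).trans hN)
  · simp [hK n h]

theorem ev_mode_generating (u v w : RA A) : ∃ N₀, ∀ N, N₀ ≤ N → ∀ (n : ℕ) (i : Fin 2) (t x y : F),
    ∑ r ∈ Finset.range N, (t ^ r * (r.factorial : F)⁻¹) •
        ev i x y ((raOps F A).mode r ((raOps F A).mode n u v) w) =
      (x + t) ^ delta0 i • (ev i x (-(x + t)) ((raOps F A).mode n u v) * ev i (x + t) y w) -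
      (-(y + t)) ^ delta0 i •
        (ev i x (y + t) w * ev i (-(y + t)) y ((raOps F A).mode n u v)) := by
  obtain ⟨K, hK⟩ := mode_eventually_zero F u v
  choose f hf using fun n => ev_generating (F := F) ((raOps F A).mode n u v) w
  refine ⟨(Finset.range K).sup f, fun N hN n => ?_⟩
  rcases lt_or_ge n K with h | h
  · exact hf n N ((Finset.le_sup (Finset.mem_range.2 h)).trans hN)
  · simp [hK n h]

/-- The generating function of `u_m (v_n w)`. -/
theorem ev_generating_two (u v w : RA A) : ∃ N₀, ∀ N, N₀ ≤ N → ∀ (i : Fin 2) (α β x y : F),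
    ∑ m ∈ Finset.range N, ∑ n ∈ Finset.range N,
      ((α ^ m * (m.factorial : F)⁻¹) * (β ^ n * (n.factorial : F)⁻¹)) •
        ev i x y ((raOps F A).mode m u ((raOps F A).mode n v w)) =
      (x + α) ^ delta0 i • (ev i x (-(x + α)) u *
        ((x + α + β) ^ delta0 i • (ev i (x + α) (-(x + α + β)) v * ev i (x + α + β) y w) -
        (-(y + β)) ^ delta0 i • (ev i (x + α) (y + β) w * ev i (-(y + β)) y v))) -
      (-(y + α)) ^ delta0 i •
        (((x + β) ^ delta0 i • (ev i x (-(x + β)) v * ev i (x + β) (y + α) w) -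
        (-(y + α + β)) ^ delta0 i • (ev i x (y + α + β) w * ev i (-(y + α + β)) (y + α) v)) *
          ev i (-(y + α)) y u) := by
  obtain ⟨N₁, h₁⟩ := ev_generating_mode (F := F) u v w
  obtain ⟨N₂, h₂⟩ := ev_generating (F := F) v w
  refine ⟨max N₁ N₂, fun N hN i α β x y => ?_⟩
  rw [Finset.sum_comm]
  have : ∀ n ∈ Finset.range N, ∑ m ∈ Finset.range N,
      ((α ^ m * (m.factorial : F)⁻¹) * (β ^ n * (n.factorial : F)⁻¹)) •
        ev i x y ((raOps F A).mode m u ((raOps F A).mode n v w)) =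
      (x + α) ^ delta0 i • (ev i x (-(x + α)) u * ((β ^ n * (n.factorial : F)⁻¹) •
        ev i (x + α) y ((raOps F A).mode n v w))) -
      (-(y + α)) ^ delta0 i • (((β ^ n * (n.factorial : F)⁻¹) •
        ev i x (y + α) ((raOps F A).mode n v w)) * ev i (-(y + α)) y u) := by
    intro n _
    simp only [mul_comm (α ^ _ * _) (β ^ n * _), mul_smul _ (α ^ _ * _)]
    rw [← Finset.smul_sum, h₁ N (by omega) n i α x y]
    simp only [mul_smul_comm, smul_mul_assoc, smul_sub]
    rw [smul_comm (β ^ n * (n.factorial : F)⁻¹) ((x + α) ^ delta0 i),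
      smul_comm (β ^ n * (n.factorial : F)⁻¹) ((-(y + α)) ^ delta0 i)]
  rw [Finset.sum_congr rfl this, Finset.sum_sub_distrib, ← Finset.smul_sum, ← Finset.mul_sum,
    ← Finset.smul_sum, ← Finset.sum_mul, h₂ N (by omega) i β, h₂ N (by omega) i β]

/-- Each iterated product has four terms, one for each placement of the three factors. In the
difference the terms with `w` in the middle cancel; by associativity the other four form the
generating function of the `(u_j v)_s w`, with parameter `α` for `j` and `α + β` for `s`. -/
theorem mode_commutator (m n : ℕ) (u v w : RA A) :
    (raOps F A).mode m u ((raOps F A).mode n v w) - (raOps F A).mode n v ((raOps F A).mode m u w) =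
      ∑ j ∈ Finset.range (m + 1), (m.choose j : F) •
        (raOps F A).mode (m + n - j) ((raOps F A).mode j u v) w := by
  obtain ⟨N₁, h₁⟩ := ev_generating_two (F := F) u v w
  obtain ⟨N₂, h₂⟩ := ev_generating_two (F := F) v u w
  obtain ⟨N₃, h₃⟩ := ev_generating (F := F) u v
  obtain ⟨N₄, h₄⟩ := ev_mode_generating (F := F) u v w
  obtain ⟨M, hM, hM'⟩ : ∃ M, (∀ j, M ≤ j → (raOps F A).mode j u v = 0) ∧
      ∀ j s, M ≤ s → (raOps F A).mode s ((raOps F A).mode j u v) w = 0 := by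
    obtain ⟨K, hK⟩ := mode_eventually_zero F u v
    choose f hf using fun j => mode_eventually_zero F ((raOps F A).mode j u v) w
    refine ⟨max K ((Finset.range K).sup f), fun j hj => hK j (by omega), fun j s hs => ?_⟩
    rcases lt_or_ge j K with h | h
    · exact hf j s ((Finset.le_sup (Finset.mem_range.2 h)).trans (by omega))
    · simp [hK j h]
  set N := max (max (m + 1) (n + 1)) (max (max N₁ N₂) (max (max N₃ N₄) (2 * M))) with hN
  refine sub_eq_zero.1 (eq_zero_of_ev_eq_zero (F := F) fun i x y => ?_)
  let X : ℕ → ℕ → A := fun m n => ev i x y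
    ((raOps F A).mode m u ((raOps F A).mode n v w) - (raOps F A).mode n v ((raOps F A).mode m u w) -
      ∑ j ∈ Finset.range (m + 1), (m.choose j : F) •
        (raOps F A).mode (m + n - j) ((raOps F A).mode j u v) w)
  have hX : ∀ α β : F, ∑ m ∈ Finset.range N, ∑ n ∈ Finset.range N,
      ((α ^ m * (m.factorial : F)⁻¹) * (β ^ n * (n.factorial : F)⁻¹)) • X m n = 0 := by
    intro α β
    simp only [X, map_sub, smul_sub, Finset.sum_sub_distrib, map_sum, map_smul]
    have e₁ := h₁ N (by omega) i α β x y
    have e₂ := h₂ N (by omega) i β α x y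
    rw [Finset.sum_comm] at e₂
    simp only [mul_comm (β ^ _ * _) (α ^ _ * _)] at e₂
    have e₃ := sum_sum_choose_smul (N := N) (M := M) (by omega)
      (B := fun j s => ev i x y ((raOps F A).mode s ((raOps F A).mode j u v) w))
      (fun j s hj => by simp [hM j hj]) (fun j s hs => by simp [hM' j s hs]) α β
    simp only [h₄ N (by omega) _ i (α + β) x y] at e₃
    have e₄ : ∀ j ∈ Finset.range N, (α ^ j * (j.factorial : F)⁻¹) •
        ((x + (α + β)) ^ delta0 i • (ev i x (-(x + (α + β))) ((raOps F A).mode j u v) *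
          ev i (x + (α + β)) y w) - (-(y + (α + β))) ^ delta0 i •
        (ev i x (y + (α + β)) w * ev i (-(y + (α + β))) y ((raOps F A).mode j u v))) =
        (x + (α + β)) ^ delta0 i • (((α ^ j * (j.factorial : F)⁻¹) •
          ev i x (-(x + (α + β))) ((raOps F A).mode j u v)) * ev i (x + (α + β)) y w) -
        (-(y + (α + β))) ^ delta0 i • (ev i x (y + (α + β)) w * ((α ^ j * (j.factorial : F)⁻¹) •
          ev i (-(y + (α + β))) y ((raOps F A).mode j u v))) := by
      intro j _
      simp only [mul_smul_comm, smul_mul_assoc, smul_sub]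
      rw [smul_comm (α ^ j * (j.factorial : F)⁻¹) ((x + (α + β)) ^ delta0 i),
        smul_comm (α ^ j * (j.factorial : F)⁻¹) ((-(y + (α + β))) ^ delta0 i)]
    rw [Finset.sum_congr rfl e₄, Finset.sum_sub_distrib, ← Finset.smul_sum, ← Finset.sum_mul,
      ← Finset.smul_sum, ← Finset.mul_sum, h₃ N (by omega) i α, h₃ N (by omega) i α] at e₃
    rw [e₁, e₂, e₃]
    simp only [show -(x + α + β) + α = -(x + β) by ring, show -(y + α + β) + α = -(y + β) by ring,
      show x + β + α = x + α + β by ring, show y + β + α = y + α + β by ring,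
      show x + (α + β) = x + α + β by ring, show y + (α + β) = y + α + β by ring, neg_neg]
    simp only [mul_sub, sub_mul, smul_sub, mul_smul_comm, smul_mul_assoc, mul_assoc, smul_smul]
    match_scalars <;> ring
  have h0 := eq_zero_of_sum_pow_smul_eq_zero (F := F) (N := N)
    (a := fun n => (n.factorial : F)⁻¹ • (m.factorial : F)⁻¹ • X m n) (fun β => by
      refine eq_zero_of_sum_pow_smul_eq_zero (F := F) (N := N)
        (a := fun m => ∑ n ∈ Finset.range N, β ^ n • (n.factorial : F)⁻¹ • (m.factorial : F)⁻¹ • X m n)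
        (fun α => ?_) m (by omega)
      rw [← hX α β]
      refine Finset.sum_congr rfl fun m _ => ?_
      rw [Finset.smul_sum]
      refine Finset.sum_congr rfl fun n _ => ?_
      simp only [smul_smul]
      congr 1
      ring) n (by omega)
  rw [smul_eq_zero, smul_eq_zero, inv_eq_zero, inv_eq_zero] at h0
  rcases h0 with h0 | h0 | h0
  · exact absurd h0 (Nat.cast_ne_zero.2 n.factorial_ne_zero)
  · exact absurd h0 (Nat.cast_ne_zero.2 m.factorial_ne_zero)
  · exact h0

/-- A subspace of `R(A)` that is closed under the operations is a conformal algebra. -/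
theorem isConformalAlgebra_of_closed {W : Submodule F (RA A)}
    (hdel : ∀ u ∈ W, (raOps F A).del u ∈ W)
    (hmode : ∀ n, ∀ u ∈ W, ∀ v ∈ W, (raOps F A).mode n u v ∈ W) :
    IsConformalAlgebra (raOps F A) W where
  del_mem := hdel
  mode_mem := hmode
  eventually_zero u _ v _ := mode_eventually_zero F u v
  del_zero u _ v _ := (mode_del F u v).1
  del_succ n u _ v _ := (mode_del F u v).2 n
  skew n N u _ v _ h := mode_skew n N u v h
  commutator m n u _ v _ w _ := mode_commutator m n u v w

end Axioms

/-! ### The fixed subspaces of the twisted transpose -/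

section Transpose

variable {F : Type*} [Field F] {k : ℕ}

variable (F) in
/-- The sign `(-1)ⁱ` of the involution on the `i`-th component. -/
def sgn (i : Fin 2) : F := (-1) ^ (i : ℕ)

theorem sgn_mul_self (i : Fin 2) : sgn F i * sgn F i = 1 := by
  fin_cases i <;> simp [sgn]

theorem sgn_ne_zero (i : Fin 2) : sgn F i ≠ 0 := left_ne_zero_of_mul_eq_one (sgn_mul_self i)

theorem neg_one_pow_one_sub_delta0 (i : Fin 2) : (-1 : F) ^ (1 - delta0 i) = sgn F i := by
  fin_cases i <;> simp [sgn, delta0]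

theorem neg_one_pow_delta0 (i : Fin 2) : (-1 : F) ^ delta0 i = -sgn F i := by
  fin_cases i <;> simp [sgn, delta0]

variable (F k) in
/-- The symmetrization `u xᵐ yⁿ + (-1)ⁱ uᵗ xⁿ yᵐ` of a monomial. -/
noncomputable def sy (i : Fin 2) (m n : ℕ) : Mat F k →ₗ[F] RA (Mat F k) :=
  mon F i m n + sgn F i • (mon F i n m ∘ₗ (Matrix.transposeLinearEquiv _ _ F F).toLinearMap)

theorem sy_apply (i : Fin 2) (m n : ℕ) (a : Mat F k) :
    sy F k i m n a = mon F i m n a + sgn F i • mon F i n m a.transpose := rfl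

theorem sy_swap (i : Fin 2) (m n : ℕ) (a : Mat F k) :
    sy F k i n m a.transpose = sgn F i • sy F k i m n a := by
  rw [sy_apply, sy_apply, Matrix.transpose_transpose, smul_add, smul_smul, sgn_mul_self, one_smul,
    add_comm]

theorem sy_one_swap (i : Fin 2) (m n : ℕ) : sy F 1 i n m 1 = sgn F i • sy F 1 i m n 1 := by
  rw [← sy_swap, Matrix.transpose_one]

theorem del_sy (i : Fin 2) (m n : ℕ) (a : Mat F k) :
    (raOps F (Mat F k)).del (sy F k i m n a) = sy F k i (m + 1) n a + sy F k i m (n + 1) a := by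
  simp only [sy_apply, map_add, map_smul, del_mon, smul_add]
  abel

variable (F k) in
/-- The symmetrization of the first family of terms in the product of two monomials. -/
noncomputable def syTerm (r : ℕ) (i : Fin 2) (m₁ m₂ n₁ n₂ : ℕ) (a b : Mat F k) : RA (Mat F k) :=
  ((-1) ^ m₂ * ((m₂ + n₁ + delta0 i).descFactorial r : F)) •
    sy F k i (m₁ + m₂ + n₁ + delta0 i - r) n₂ (a * b)

theorem syTerm_eq_zero {r : ℕ} {i : Fin 2} {m₂ n₁ : ℕ} (h : m₂ + n₁ + delta0 i < r) (m₁ n₂ : ℕ)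
    (a b : Mat F k) : syTerm F k r i m₁ m₂ n₁ n₂ a b = 0 := by
  rw [syTerm, Nat.descFactorial_of_lt h]; simp

/-- Four pairs of monomials with two terms each give eight terms. Transposition reverses products,
so the second term of each pair is the mirror image of the first term of the pair with both factors
transposed. -/
theorem mode_sy (r : ℕ) (i : Fin 2) (m₁ m₂ n₁ n₂ : ℕ) (a b : Mat F k) :
    (raOps F (Mat F k)).mode r (sy F k i m₁ m₂ a) (sy F k i n₁ n₂ b) =
      syTerm F k r i m₁ m₂ n₁ n₂ a b + sgn F i • syTerm F k r i m₂ m₁ n₁ n₂ a.transpose b +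
      sgn F i • syTerm F k r i m₁ m₂ n₂ n₁ a b.transpose +
      syTerm F k r i m₂ m₁ n₂ n₁ a.transpose b.transpose := by
  -- Since `(-1)^δ = -(-1)ⁱ`, the minus sign before the second family becomes the sign of the
  -- symmetrization.
  have hs : ∀ m, (-1 : F) ^ (m + delta0 i) = -(sgn F i * (-1) ^ m) := fun m => by
    rw [pow_add, neg_one_pow_delta0]; ring
  simp only [sy_apply, syTerm, map_add, map_smul, LinearMap.add_apply, LinearMap.smul_apply,
    mode_mon, Matrix.transpose_mul, Matrix.transpose_transpose, hs, add_comm m₂ m₁]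
  rcases mul_self_eq_one_iff.1 (sgn_mul_self (F := F) i) with h | h <;>
    simp only [h] <;> module

variable (F k) in
/-- `R^*_{k×k,1}` for `i = 1`, and `R^*_{k×k,2}` for `i = 0`. -/
noncomputable def RStar (i : Fin 2) : Submodule F (RA (Mat F k)) :=
  Submodule.span F {x | ∃ (m n : ℕ) (a : Mat F k), x = sy F k i m n a}

theorem sy_mem (i : Fin 2) (m n : ℕ) (a : Mat F k) : sy F k i m n a ∈ RStar F k i :=
  Submodule.subset_span ⟨m, n, a, rfl⟩

theorem RStar_le {i : Fin 2} {P : Submodule F (RA (Mat F k))}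
    (h : ∀ m n a, sy F k i m n a ∈ P) : RStar F k i ≤ P := by
  refine Submodule.span_le.2 ?_
  rintro _ ⟨m, n, a, rfl⟩
  exact h m n a

theorem syTerm_mem (r : ℕ) (i : Fin 2) (m₁ m₂ n₁ n₂ : ℕ) (a b : Mat F k) :
    syTerm F k r i m₁ m₂ n₁ n₂ a b ∈ RStar F k i :=
  Submodule.smul_mem _ _ (sy_mem _ _ _ _)

theorem del_mem_RStar (i : Fin 2) : ∀ u ∈ RStar F k i, (raOps F (Mat F k)).del u ∈ RStar F k i := by
  intro u hu
  refine (RStar_le (P := (RStar F k i).comap (raOps F (Mat F k)).del) fun m n a => ?_) hu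
  rw [Submodule.mem_comap, del_sy]
  exact add_mem (sy_mem _ _ _ _) (sy_mem _ _ _ _)

theorem mode_mem_RStar (i : Fin 2) : ∀ n, ∀ u ∈ RStar F k i, ∀ v ∈ RStar F k i,
    (raOps F (Mat F k)).mode n u v ∈ RStar F k i := by
  intro r u hu v hv
  refine (RStar_le (P := (RStar F k i).comap (((raOps F (Mat F k)).mode r).flip v))
    fun m₁ m₂ a => ?_) hu
  refine (RStar_le (P := (RStar F k i).comap ((raOps F (Mat F k)).mode r (sy F k i m₁ m₂ a)))
    fun n₁ n₂ b => ?_) hv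
  rw [Submodule.mem_comap, mode_sy]
  exact add_mem (add_mem (add_mem (syTerm_mem _ _ _ _ _ _ _ _)
    (Submodule.smul_mem _ _ (syTerm_mem _ _ _ _ _ _ _ _)))
    (Submodule.smul_mem _ _ (syTerm_mem _ _ _ _ _ _ _ _))) (syTerm_mem _ _ _ _ _ _ _ _)

/-- A linear map on matrices takes its values in `P` if it does so on the matrix units. -/
theorem map_mem_of_unitMat {V : Type*} [AddCommGroup V] [Module F V] {P : Submodule F V}
    {f : Mat F k →ₗ[F] V} (h : ∀ p q, f (unitMat F k p q) ∈ P) (a : Mat F k) : f a ∈ P := by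
  rw [Matrix.matrix_eq_sum_single a, map_sum]
  refine Submodule.sum_mem _ fun p _ => ?_
  rw [map_sum]
  refine Submodule.sum_mem _ fun q _ => ?_
  have : Matrix.single p q (a p q) = a p q • unitMat F k p q := by
    rw [unitMat, Matrix.smul_single, smul_eq_mul, mul_one]
  rw [this, map_smul]
  exact Submodule.smul_mem _ _ (h p q)

theorem transpose_unitMat (p q : Fin k) : (unitMat F k p q).transpose = unitMat F k q p :=
  Matrix.transpose_single _ _ _

theorem unitMat_mul_same (p q r : Fin k) :
    unitMat F k p q * unitMat F k q r = unitMat F k p r := by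
  simp [unitMat]

theorem unitMat_mul_of_ne {q q' : Fin k} (h : q ≠ q') (p r : Fin k) :
    unitMat F k p q * unitMat F k q' r = 0 := by
  simp [unitMat, h]

theorem sy_eq_elt (i : Fin 2) (m n : ℕ) (a : Mat F k) :
    sy F k i m n a = ((m.factorial : F) * (n.factorial : F)) •
      (elt i m n a + sgn F i • elt i n m a.transpose) := by
  rw [sy_apply, mon_eq, mon_eq, smul_add, smul_comm (sgn F i), mul_comm (n.factorial : F)]

theorem elt_add_eq_sy [CharZero F] (i : Fin 2) (m n : ℕ) (a : Mat F k) :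
    elt i m n a + sgn F i • elt i n m a.transpose =
      ((m.factorial : F) * (n.factorial : F))⁻¹ • sy F k i m n a := by
  rw [sy_eq_elt, smul_smul, inv_mul_cancel₀, one_smul]
  exact mul_ne_zero (Nat.cast_ne_zero.2 m.factorial_ne_zero) (Nat.cast_ne_zero.2 n.factorial_ne_zero)

theorem elt_sub_eq_sy [CharZero F] (m n : ℕ) (a : Mat F k) :
    elt 1 m n a - elt 1 n m a.transpose =
      ((m.factorial : F) * (n.factorial : F))⁻¹ • sy F k 1 m n a := by
  rw [← elt_add_eq_sy]
  simp [sgn, sub_eq_add_neg]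

theorem elt_add_eq_sy_zero [CharZero F] (m n : ℕ) (a : Mat F k) :
    elt 0 m n a + elt 0 n m a.transpose =
      ((m.factorial : F) * (n.factorial : F))⁻¹ • sy F k 0 m n a := by
  rw [← elt_add_eq_sy]
  simp [sgn]

variable (F k) in
theorem RStar1_eq [CharZero F] : RStar1 F k = RStar F k 1 := by
  refine le_antisymm (Submodule.span_le.2 ?_) (RStar_le fun m n => map_mem_of_unitMat fun p q => ?_)
  · rintro _ ⟨p, q, m, n, rfl⟩
    rw [← transpose_unitMat p q, elt_sub_eq_sy]
    exact Submodule.smul_mem _ _ (sy_mem _ _ _ _)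
  · rw [sy_eq_elt]
    refine Submodule.smul_mem _ _ (Submodule.subset_span ⟨p, q, m, n, ?_⟩)
    simp [sgn, transpose_unitMat, sub_eq_add_neg]

variable (F k) in
theorem RStar2_eq [CharZero F] : RStar2 F k = RStar F k 0 := by
  refine le_antisymm (Submodule.span_le.2 ?_) (RStar_le fun m n => map_mem_of_unitMat fun p q => ?_)
  · rintro _ ⟨p, q, m, n, rfl⟩
    rw [← transpose_unitMat p q, elt_add_eq_sy_zero]
    exact Submodule.smul_mem _ _ (sy_mem _ _ _ _)
  · rw [sy_eq_elt]
    refine Submodule.smul_mem _ _ (Submodule.subset_span ⟨p, q, m, n, ?_⟩)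
    simp [sgn, transpose_unitMat]

theorem RStar_le_RSigma (i : Fin 2) :
    RStar F k i ≤ RSigma F (Matrix.transpose : Mat F k → Mat F k) := by
  refine RStar_le fun m n a => ?_
  rw [sy_eq_elt]
  exact Submodule.smul_mem _ _ (Submodule.subset_span ⟨i, m, n, a, rfl⟩)

theorem mon_apply (i j : Fin 2) (m n m' n' : ℕ) (a : Mat F k) :
    mon F i m n a (j, m', n') =
      if i = j ∧ m = m' ∧ n = n' then ((m.factorial : F) * (n.factorial : F)) • a else 0 := by
  rw [mon_eq, elt, Finsupp.smul_apply, Finsupp.single_apply]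
  simp only [Prod.mk.injEq]
  split_ifs <;> simp

/-- The elements of `RStar F k i` have no components of index `j ≠ i`, and are fixed by the twisted
transpose. -/
theorem RStar_symm {i : Fin 2} {w : RA (Mat F k)} (hw : w ∈ RStar F k i) :
    (∀ j, j ≠ i → ∀ m n, w (j, m, n) = 0) ∧
      ∀ m n, w (i, n, m) = sgn F i • (w (i, m, n)).transpose := by
  induction hw using Submodule.span_induction with
  | mem x hx =>
    obtain ⟨m, n, a, rfl⟩ := hx
    refine ⟨fun j hj m' n' => ?_, fun m' n' => ?_⟩
    · simp [sy_apply, mon_apply, hj.symm]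
    · simp only [sy_apply, Finsupp.add_apply, Finsupp.smul_apply, mon_apply, true_and,
        Matrix.transpose_add, Matrix.transpose_smul, smul_add, smul_smul]
      rw [add_comm]
      simp only [apply_ite Matrix.transpose, Matrix.transpose_smul, Matrix.transpose_zero,
        Matrix.transpose_transpose, sgn_mul_self, one_smul, and_comm,
        mul_comm (n.factorial : F)]
  | zero => simp
  | add x y _ _ hx hy =>
    refine ⟨fun j hj m n => ?_, fun m n => ?_⟩
    · rw [Finsupp.add_apply, hx.1 j hj, hy.1 j hj, add_zero]
    · rw [Finsupp.add_apply, Finsupp.add_apply, hx.2, hy.2, Matrix.transpose_add, smul_add]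
  | smul c x _ hx =>
    refine ⟨fun j hj m n => ?_, fun m n => ?_⟩
    · rw [Finsupp.smul_apply, hx.1 j hj, smul_zero]
    · rw [Finsupp.smul_apply, Finsupp.smul_apply, hx.2, Matrix.transpose_smul, smul_comm]

end Transpose

/-! ### Simplicity -/

section Simple

variable {F : Type*} [Field F] [CharZero F] {k : ℕ}

/-- The highest product of `a xᴹ yᴺ + (-1)ⁱ aᵗ xᴺ yᴹ`, where `M < N`, with a monomial whose degrees
in `x` and `y` are at most `D`. -/
theorem mode_sy_mon_top {i : Fin 2} {M N D n₁ n₂ : ℕ} (hMN : M < N) (h₁ : n₁ ≤ D) (h₂ : n₂ ≤ D)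
    (a b : Mat F k) :
    (raOps F (Mat F k)).mode (N + D + delta0 i) (sy F k i M N a) (mon F i n₁ n₂ b) =
      ((-1) ^ N * ((N + D + delta0 i).factorial : F)) •
        ((if n₁ = D then mon F i M n₂ (a * b) else 0) +
          if n₂ = D then mon F i n₁ M (b * a.transpose) else 0) := by
  have hs : (-1 : F) ^ (N + delta0 i) = -(sgn F i * (-1) ^ N) := by
    rw [pow_add, neg_one_pow_delta0]; ring
  -- As `M < N`, the terms whose falling factorial is built on `M` do not reach the order `N + D +
  -- δ`.
  have e₁ : (M + n₂ + delta0 i).descFactorial (N + D + delta0 i) = 0 :=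
    Nat.descFactorial_of_lt (by omega)
  have e₂ : (M + n₁ + delta0 i).descFactorial (N + D + delta0 i) = 0 :=
    Nat.descFactorial_of_lt (by omega)
  rw [sy_apply, map_add, map_smul, LinearMap.add_apply, LinearMap.smul_apply, mode_mon, mode_mon,
    e₁, e₂, hs]
  simp only [Nat.cast_zero, mul_zero, zero_smul, sub_zero, zero_sub, neg_mul, neg_smul,
    neg_neg, smul_smul, smul_add]
  rw [← mul_assoc, ← mul_assoc, sgn_mul_self, one_mul]
  congr 1
  · split_ifs with h
    · rw [h, Nat.descFactorial_self, show M + N + D + delta0 i - (N + D + delta0 i) = M by omega]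
    · rw [Nat.descFactorial_of_lt (by omega)]; simp
  · split_ifs with h
    · rw [h, Nat.descFactorial_self, show N + M + D + delta0 i - (N + D + delta0 i) = M by omega]
    · rw [Nat.descFactorial_of_lt (by omega)]; simp

theorem eq_sum_mon {i : Fin 2} {w : RA (Mat F k)} (hw : ∀ j, j ≠ i → ∀ m n, w (j, m, n) = 0)
    {D : ℕ} (hD : ∀ m n, w (i, m, n) ≠ 0 → m ≤ D ∧ n ≤ D) :
    w = ∑ m ∈ Finset.range (D + 1), ∑ n ∈ Finset.range (D + 1),
      mon F i m n (((m.factorial : F) * (n.factorial : F))⁻¹ • w (i, m, n)) := by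
  ext1 ⟨j, m, n⟩
  simp only [Finsupp.finsetSum_apply, mon_apply]
  by_cases hij : i = j
  · subst hij
    have h0 : ((m.factorial : F) * (n.factorial : F)) ≠ 0 := mul_ne_zero
      (Nat.cast_ne_zero.2 m.factorial_ne_zero) (Nat.cast_ne_zero.2 n.factorial_ne_zero)
    by_cases hmn : w (i, m, n) = 0
    · rw [hmn, Finset.sum_eq_zero]
      intro m' _
      refine Finset.sum_eq_zero fun n' _ => ?_
      split_ifs with h
      · rw [h.2.1, h.2.2, hmn]; simp
      · rfl
    · obtain ⟨hm, hn⟩ := hD m n hmn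
      rw [Finset.sum_eq_single m, Finset.sum_eq_single n]
      · rw [if_pos ⟨rfl, rfl, rfl⟩, smul_smul, mul_inv_cancel₀ h0, one_smul]
      · intro n' _ h; simp [h]
      · intro h; exact absurd (Finset.mem_range.2 (Nat.lt_succ_of_le hn)) h
      · intro m' _ h; simp [h]
      · intro h; exact absurd (Finset.mem_range.2 (Nat.lt_succ_of_le hm)) h
  · simp [hij, hw j (Ne.symm hij)]

variable {i : Fin 2} {I : Submodule F (RA (Mat F k))}

/-- A nonzero ideal contains the symmetrizations of `a xᴹ h(y)`, for some nonzero `h` and all `a`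
and `M`. -/
theorem IsIdeal.exists_row (hI : IsIdeal (raOps F (Mat F k)) (RStar F k i) I) (hne : I ≠ ⊥) :
    ∃ (D e : ℕ) (h : ℕ → Mat F k), e ≤ D ∧ h e ≠ 0 ∧ (∀ n, e < n → h n = 0) ∧
      ∀ M a, ∑ n ∈ Finset.range (D + 1), sy F k i M n (a * h n) ∈ I := by
  obtain ⟨w, hwI, hw0⟩ := Submodule.exists_mem_ne_zero_of_ne_bot hne
  obtain ⟨hc, hs⟩ := RStar_symm (hI.le hwI)
  have hsupp : w.support.Nonempty := Finsupp.support_nonempty_iff.2 hw0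
  -- `D` is the degree of `w` in `x`, and by the symmetry of `w` also bounds its degree in `y`.
  set D := w.support.sup fun t => t.2.1 with hDdef
  have hle : ∀ m n, w (i, m, n) ≠ 0 → m ≤ D := fun m n h =>
    Finset.le_sup (f := fun t : Fin 2 × ℕ × ℕ => t.2.1) (Finsupp.mem_support_iff.2 h)
  have hle' : ∀ m n, w (i, m, n) ≠ 0 → m ≤ D ∧ n ≤ D := fun m n h => by
    refine ⟨hle m n h, hle n m fun h' => h ?_⟩
    rw [hs n m, h', Matrix.transpose_zero, smul_zero]
  obtain ⟨⟨j, m₀, n₀⟩, ht, htD⟩ := Finset.exists_mem_eq_sup _ hsupp (fun t => t.2.1)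
  have hji : j = i := by
    by_contra h
    exact Finsupp.mem_support_iff.1 ht (hc j h _ _)
  subst hji
  have hm₀ : m₀ = D := htD.symm
  have hn₀ : w (j, D, n₀) ≠ 0 := hm₀ ▸ Finsupp.mem_support_iff.1 ht
  -- The `h n` are the coefficients of `x^D yⁿ` in the polynomial of `w`; `e` will be the degree of
  -- `h(y)`.
  set h : ℕ → Mat F k := fun n => ((D.factorial : F) * (n.factorial : F))⁻¹ • w (j, D, n) with hh
  have hne0 : ∀ m n : ℕ, ((m.factorial : F) * (n.factorial : F)) ≠ 0 := fun m n => mul_ne_zero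
    (Nat.cast_ne_zero.2 m.factorial_ne_zero) (Nat.cast_ne_zero.2 n.factorial_ne_zero)
  classical
  have he : w (j, D, Nat.findGreatest (fun n => w (j, D, n) ≠ 0) D) ≠ 0 :=
    Nat.findGreatest_spec (P := fun n => w (j, D, n) ≠ 0) (hle' _ _ hn₀).2 hn₀
  refine ⟨D, Nat.findGreatest (fun n => w (j, D, n) ≠ 0) D, h, Nat.findGreatest_le _,
    smul_ne_zero (inv_ne_zero (hne0 _ _)) he, fun n hn => ?_, fun M a => ?_⟩
  · by_contra hn'
    have hn'' : w (j, D, n) ≠ 0 := fun h0 => hn' (by rw [hh]; simp [h0])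
    exact Nat.findGreatest_is_greatest hn (hle' _ _ hn'').2 hn''
  -- At this order only the monomials of `w` with `m = D` or `n = D` survive. The two kinds are
  -- mirror images, so together they give the symmetrization of `a x^M h(y)`.
  · have hmem := hI.mode_mem (M + 1 + D + delta0 j) _ (sy_mem j M (M + 1) a) w hwI
    rw [eq_sum_mon hc hle'] at hmem
    simp only [map_sum] at hmem
    have hsum : ∀ m ∈ Finset.range (D + 1), ∀ n ∈ Finset.range (D + 1),
        (raOps F (Mat F k)).mode (M + 1 + D + delta0 j) (sy F k j M (M + 1) a)
          (mon F j m n (((m.factorial : F) * (n.factorial : F))⁻¹ • w (j, m, n))) =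
        ((-1) ^ (M + 1) * ((M + 1 + D + delta0 j).factorial : F)) •
          ((if m = D then mon F j M n (a * h n) else 0) +
            if n = D then sgn F j • mon F j m M (a * h m).transpose else 0) := by
      intro m hm n hn
      rw [Finset.mem_range] at hm hn
      rw [mode_sy_mon_top (Nat.lt_succ_self M) (by omega) (by omega)]
      congr 2
      · split_ifs with h1
        · rw [h1]
        · rfl
      · split_ifs with h1
        · rw [h1, hs D m, hh, Matrix.transpose_mul, Matrix.transpose_smul, ← map_smul,
            mul_comm (m.factorial : F), smul_comm, smul_mul_assoc]
        · rfl
    rw [Finset.sum_congr rfl fun m hm => Finset.sum_congr rfl (hsum m hm)] at hmem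
    simp only [← Finset.smul_sum, Finset.sum_add_distrib] at hmem
    rw [Finset.sum_comm] at hmem
    simp only [Finset.sum_ite_eq', Finset.mem_range, Nat.lt_succ_self, if_true] at hmem
    rw [← Finset.sum_add_distrib] at hmem
    refine (Submodule.smul_mem_iff _ (mul_ne_zero (pow_ne_zero _ (neg_ne_zero.2 one_ne_zero))
      (Nat.cast_ne_zero.2 (Nat.factorial_ne_zero _)))).1 hmem

/-- In the product of order `P + 1 + e + δ` of `u x^P y^(P+1)` with a row, two of the four families
of `mode_sy` are multiples of rows, hence already in `I`; one vanishes; the last retains only `n =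
e`, the leading coefficient of `h`. -/
theorem IsIdeal.sy_mem_of_ne_bot (hI : IsIdeal (raOps F (Mat F k)) (RStar F k i) I) (hne : I ≠ ⊥)
    (P M : ℕ) (a : Mat F k) : sy F k i P M a ∈ I := by
  obtain ⟨D, e, h, heD, he, hlt, hrow⟩ := hI.exists_row hne
  have hterm : ∀ (r m₁ m₂ : ℕ) (u a : Mat F k),
      ∑ n ∈ Finset.range (D + 1), syTerm F k r i m₁ m₂ M n u (a * h n) ∈ I := by
    intro r m₁ m₂ u a
    simp only [syTerm, ← Finset.smul_sum, ← mul_assoc]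
    exact Submodule.smul_mem _ _ (hrow _ _)
  have hmul : ∀ u a : Mat F k, sy F k i P M (u * (a * h e).transpose) ∈ I := by
    intro u a
    have hmem := hI.mode_mem (P + 1 + e + delta0 i) _ (sy_mem i P (P + 1) u) _ (hrow M a)
    simp only [map_sum, mode_sy, Finset.sum_add_distrib, ← Finset.smul_sum] at hmem
    have h4 : ∑ n ∈ Finset.range (D + 1), syTerm F k (P + 1 + e + delta0 i) i (P + 1) P n M
        u.transpose (a * h n).transpose = 0 := by
      refine Finset.sum_eq_zero fun n _ => ?_
      rcases le_or_gt n e with hn | hn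
      · exact syTerm_eq_zero (by omega) _ _ _ _
      · rw [hlt n hn]; simp [syTerm]
    have h3 : ∑ n ∈ Finset.range (D + 1), syTerm F k (P + 1 + e + delta0 i) i P (P + 1) n M
        u (a * h n).transpose = ((-1) ^ (P + 1) * ((P + 1 + e + delta0 i).factorial : F)) •
          sy F k i P M (u * (a * h e).transpose) := by
      rw [Finset.sum_eq_single e]
      · rw [syTerm, Nat.descFactorial_self,
          show P + (P + 1) + e + delta0 i - (P + 1 + e + delta0 i) = P by omega]
      · intro n _ hn
        rcases lt_or_gt_of_ne hn with hn | hn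
        · exact syTerm_eq_zero (by omega) _ _ _ _
        · rw [hlt n hn]; simp [syTerm]
      · intro hn
        exact absurd (Finset.mem_range.2 (Nat.lt_succ_of_le heD)) hn
    rw [h4, add_zero, h3] at hmem
    have := (Submodule.add_mem_iff_right I (add_mem (hterm _ _ _ _ _)
      (Submodule.smul_mem _ _ (hterm _ _ _ _ _)))).1 hmem
    rw [smul_smul] at this
    exact (Submodule.smul_mem_iff _ (mul_ne_zero (sgn_ne_zero i) (mul_ne_zero
      (pow_ne_zero _ (neg_ne_zero.2 one_ne_zero))
      (Nat.cast_ne_zero.2 (Nat.factorial_ne_zero _))))).1 this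
  obtain ⟨p, q, hpq⟩ : ∃ p q, h e p q ≠ 0 := by
    by_contra! h0
    exact he (Matrix.ext h0)
  refine map_mem_of_unitMat (fun s t => ?_) a
  -- `E_sq (E_tp h)ᵗ = E_sq hᵗ E_pt` picks out the nonzero entry `h p q` of the leading coefficient
  -- and moves it to position `(s, t)`.
  have hst := hmul (unitMat F k s q) (unitMat F k t p)
  have : unitMat F k s q * (unitMat F k t p * h e).transpose = h e p q • unitMat F k s t := by
    rw [Matrix.transpose_mul, transpose_unitMat, unitMat, unitMat, ← mul_assoc,
      Matrix.single_mul_mul_single]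
    simp [unitMat]
  rw [this, map_smul] at hst
  exact (Submodule.smul_mem_iff _ hpq).1 hst

theorem isSimpleConformal_RStar (hk : 0 < k) (i : Fin 2) :
    IsSimpleConformal (raOps F (Mat F k)) (RStar F k i) := by
  refine ⟨fun h => ?_, fun I hI => ?_⟩
  -- Degree `(1, 0)` serves both values of `i`; the symmetrization of `1` in degree `(0, 0)` is zero
  -- for `i = 1`.
  · have h1 : sy F k i 1 0 1 = 0 := (Submodule.mem_bot F).1 (h ▸ sy_mem i 1 0 1)
    have h2 := DFunLike.congr_fun h1 (i, 1, 0)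
    have h3 := congrFun (congrFun h2 ⟨0, hk⟩) ⟨0, hk⟩
    simp [sy_apply, mon_apply] at h3
  · by_cases hne : I = ⊥
    · exact Or.inl hne
    · exact Or.inr (le_antisymm hI.le (RStar_le fun P M a => hI.sy_mem_of_ne_bot hne P M a))

end Simple

/-! ### Generators -/

section Generated

variable {F V : Type*} [Field F] [AddCommGroup V] [Module F V] {C : ConformalOps F V} {S : Set V}

theorem subset_generatedBy : S ⊆ generatedBy C S :=
  fun v hv => Submodule.subset_span ⟨[], by simp, v, hv, rfl⟩

theorem mode_mem_generatedBy_of_mem {u x : V} (hu : u ∈ S) (n : ℕ) (hx : x ∈ generatedBy C S) :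
    C.mode n u x ∈ generatedBy C S := by
  suffices h : generatedBy C S ≤ (generatedBy C S).comap (C.mode n u) from h hx
  refine Submodule.span_le.2 ?_
  rintro _ ⟨L, hL, v, hv, rfl⟩
  refine Submodule.subset_span ⟨(u, n) :: L, ?_, v, hv, rfl⟩
  intro a ha
  rcases List.mem_cons.1 ha with rfl | ha
  · exact hu
  · exact hL a ha

theorem generatedBy_le {W : Submodule F V} (hS : S ⊆ W)
    (hW : ∀ n, ∀ u ∈ S, ∀ v ∈ W, C.mode n u v ∈ W) : generatedBy C S ≤ W := by
  refine Submodule.span_le.2 ?_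
  rintro _ ⟨L, hL, v, hv, rfl⟩
  induction L with
  | nil => exact hS hv
  | cons a L ih =>
    exact hW _ _ (hL a List.mem_cons_self) _ (ih fun b hb => hL b (List.mem_cons_of_mem _ hb))

/-- By the commutator formula, the subspace generated by `S` is closed under all products. -/
theorem mode_mem_generatedBy {A : Type*} [Ring A] [Algebra F A] [CharZero F] {S : Set (RA A)}
    {u x : RA A} (hu : u ∈ generatedBy (raOps F A) S) (n : ℕ) (hx : x ∈ generatedBy (raOps F A) S) :
    (raOps F A).mode n u x ∈ generatedBy (raOps F A) S := by
  set G := generatedBy (raOps F A) S with hG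
  -- `P` consists of the elements all of whose products map `G` into itself.
  let P : Submodule F (RA A) := ⨅ (n : ℕ) (x : G), G.comap (((raOps F A).mode n).flip x.1)
  have hP : ∀ u, u ∈ P ↔ ∀ n, ∀ x ∈ G, (raOps F A).mode n u x ∈ G := by
    intro u
    simp [P, Submodule.mem_iInf]
  suffices h : G ≤ P from (hP u).1 (h hu) n x hx
  refine generatedBy_le (fun u hu => (hP u).2 fun n x hx => mode_mem_generatedBy_of_mem hu n hx) ?_
  intro m u hu v hv
  induction m using Nat.strong_induction_on with
  | _ m ih =>
    refine (hP _).2 fun n x hx => ?_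
    have h := mode_commutator (F := F) m n u v x
    -- The summand `j = m` is `(u_m v)_n x`; the remaining ones involve `u_j v` with `j < m`,
    -- covered by induction.
    rw [Finset.sum_range_succ, Nat.choose_self, Nat.cast_one, one_smul, Nat.add_sub_cancel_left] at h
    rw [← sub_eq_iff_eq_add'.2 h]
    refine sub_mem (sub_mem ?_ ?_) (Submodule.sum_mem _ fun j hj => Submodule.smul_mem _ _ ?_)
    · exact mode_mem_generatedBy_of_mem hu _ ((hP v).1 hv _ _ hx)
    · exact (hP v).1 hv _ _ (mode_mem_generatedBy_of_mem hu _ hx)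
    · exact (hP _).1 (ih j (Finset.mem_range.1 hj)) _ _ hx

end Generated

/-! ### Generation by the weight-two part for `k > 1` -/

section Generators

variable {F : Type*} [Field F] {k : ℕ} {i : Fin 2} {G : Submodule F (RA (Mat F k))}

theorem sy_mem_of_sy_swap_mem {m n : ℕ} {a : Mat F k} (h : sy F k i n m a.transpose ∈ G) :
    sy F k i m n a ∈ G := by
  rw [sy_swap] at h
  exact (Submodule.smul_mem_iff _ (sgn_ne_zero i)).1 h

/-- Multiplication by `2x` on the entries in row `p`, off the diagonal. -/
theorem mode_sy_unitMat {p q : Fin k} (hpq : p ≠ q) (m n : ℕ) :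
    (raOps F (Mat F k)).mode 0 (sy F k i (1 - delta0 i) 0 (unitMat F k p p))
      (sy F k i m n (unitMat F k p q)) = (2 : F) • sy F k i (m + 1) n (unitMat F k p q) := by
  have hd := delta0_le_one i
  rw [mode_sy]
  simp only [syTerm, transpose_unitMat, unitMat_mul_same, unitMat_mul_of_ne hpq, map_zero,
    smul_zero, add_zero, Nat.descFactorial_zero, Nat.cast_one, mul_one, pow_zero, one_smul,
    neg_one_pow_one_sub_delta0, smul_smul, sgn_mul_self]
  rw [show 1 - delta0 i + m + delta0 i - 0 = m + 1 by omega,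
    show 0 + (1 - delta0 i) + m + delta0 i - 0 = m + 1 by omega, two_smul]

/-- The highest product of two symmetrized monomials. -/
theorem mode_sy_top {M N D n : ℕ} (hMN : M < N) (hn : n < D) (a b : Mat F k) :
    (raOps F (Mat F k)).mode (N + D + delta0 i) (sy F k i M N a) (sy F k i D n b) =
      ((-1) ^ N * ((N + D + delta0 i).factorial : F)) • sy F k i M n (a * b) := by
  rw [mode_sy, syTerm_eq_zero (m₂ := M) (n₁ := D) (by omega),
    syTerm_eq_zero (m₂ := N) (n₁ := n) (by omega), syTerm_eq_zero (m₂ := M) (n₁ := n) (by omega),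
    smul_zero, add_zero, add_zero, add_zero, syTerm, Nat.descFactorial_self,
    show M + N + D + delta0 i - (N + D + delta0 i) = M by omega]

variable [CharZero F]

/-- The degree `(1 - delta0 i, 0)` has weight two for both values of `i`. Starting from off-diagonal
constants, multiplication by `x` and, after transposition, by `y` yields all off-diagonal monomials;
`E_pq E_qp = E_pp` gives the diagonal ones. -/
theorem RStar_le_of_weight_two_mem (hk : 1 < k)
    (hG : ∀ n, ∀ u ∈ G, ∀ v ∈ G, (raOps F (Mat F k)).mode n u v ∈ G)
    (h2 : ∀ a, sy F k i (1 - delta0 i) 0 a ∈ G) : RStar F k i ≤ G := by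
  have hzero : ∀ p q : Fin k, p ≠ q → sy F k i 0 0 (unitMat F k p q) ∈ G := by
    intro p q hpq
    rcases Nat.le_one_iff_eq_zero_or_eq_one.1 (delta0_le_one i) with hd | hd
    -- For `i = 1` constants have weight one, and the second product of two weight-two elements
    -- lands there.
    · have h := hG 2 _ (h2 (unitMat F k p p)) _ (h2 (unitMat F k p q))
      have hs : sgn F i = -1 := by
        have := neg_one_pow_delta0 (F := F) i
        rw [hd, pow_zero] at this
        rw [this, neg_neg]
      rw [hd, mode_sy] at h
      simp only [syTerm, hd, transpose_unitMat, unitMat_mul_same, unitMat_mul_of_ne hpq, map_zero,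
        smul_zero, add_zero, hs] at h
      simp only [zero_add, tsub_zero, Nat.descFactorial, pow_one, pow_zero] at h
      simp only [smul_smul] at h
      norm_num at h
      exact h
    · simpa [hd] using h2 (unitMat F k p q)
  have hX : ∀ p q : Fin k, p ≠ q → ∀ m n, sy F k i m n (unitMat F k p q) ∈ G →
      sy F k i (m + 1) n (unitMat F k p q) ∈ G := by
    intro p q hpq m n h
    have := hG 0 _ (h2 (unitMat F k p p)) _ h
    rw [mode_sy_unitMat hpq] at this
    exact (Submodule.smul_mem_iff _ two_ne_zero).1 this
  have hoff : ∀ p q : Fin k, p ≠ q → ∀ m n, sy F k i m n (unitMat F k p q) ∈ G := by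
    have h0 : ∀ p q : Fin k, p ≠ q → ∀ m, sy F k i m 0 (unitMat F k p q) ∈ G := by
      intro p q hpq m
      induction m with
      | zero => exact hzero p q hpq
      | succ m ih => exact hX p q hpq m 0 ih
    intro p q hpq m n
    induction n with
    | zero => exact h0 p q hpq m
    | succ n ih =>
      -- Raising the `y`-degree at `E_pq` is raising the `x`-degree at `E_qp`.
      refine sy_mem_of_sy_swap_mem ?_
      rw [transpose_unitMat]
      refine hX q p hpq.symm n m (sy_mem_of_sy_swap_mem ?_)
      rwa [transpose_unitMat]
  refine RStar_le fun m n => map_mem_of_unitMat fun p q => ?_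
  by_cases hpq : p = q
  · subst hpq
    have : Nontrivial (Fin k) := Fin.nontrivial_iff_two_le.2 hk
    obtain ⟨q, hq⟩ := exists_ne p
    have h := hG (m + 1 + (n + 1) + delta0 i) _ (hoff p q hq.symm m (m + 1)) _
      (hoff q p hq (n + 1) n)
    rw [mode_sy_top (Nat.lt_succ_self m) (Nat.lt_succ_self n), unitMat_mul_same] at h
    exact (Submodule.smul_mem_iff _ (mul_ne_zero (pow_ne_zero _ (neg_ne_zero.2 one_ne_zero))
      (Nat.cast_ne_zero.2 (Nat.factorial_ne_zero _)))).1 h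
  · exact hoff p q hpq m n

/-! ### Generators for `k = 1` -/

variable {G : Submodule F (RA (Mat F 1))}

/-- For `k = 1` the zeroth product with the weight-two element is `2∂`; compare `del_sy`. -/
theorem sy_one_add_mem (hG : ∀ n, ∀ u ∈ G, ∀ v ∈ G, (raOps F (Mat F 1)).mode n u v ∈ G)
    (h2 : sy F 1 i (1 - delta0 i) 0 1 ∈ G) {m n : ℕ} (h : sy F 1 i m n 1 ∈ G) :
    sy F 1 i (m + 1) n 1 + sy F 1 i m (n + 1) 1 ∈ G := by
  have hd := delta0_le_one i
  have h' := hG 0 _ h2 _ h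
  rw [mode_sy] at h'
  simp only [syTerm, Matrix.transpose_one, Nat.descFactorial_zero, Nat.cast_one, mul_one, pow_zero,
    one_smul, neg_one_pow_one_sub_delta0, smul_smul, sgn_mul_self] at h'
  rw [show 1 - delta0 i + 0 + m + delta0 i - 0 = m + 1 by omega,
    show 0 + (1 - delta0 i) + m + delta0 i - 0 = m + 1 by omega,
    show 1 - delta0 i + 0 + n + delta0 i - 0 = n + 1 by omega,
    show 0 + (1 - delta0 i) + n + delta0 i - 0 = n + 1 by omega,
    sy_one_swap i m (n + 1), smul_smul, sgn_mul_self, one_smul] at h'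
  rw [show sy F 1 i (m + 1) n 1 + sy F 1 i (m + 1) n 1 + sy F 1 i m (n + 1) 1 +
    sy F 1 i m (n + 1) 1 = (2 : F) • (sy F 1 i (m + 1) n 1 + sy F 1 i m (n + 1) 1) by module] at h'
  exact (Submodule.smul_mem_iff _ two_ne_zero).1 h'

/-- Modulo `G`, the elements of total degree `w + 1` agree up to sign, if `G` contains those of
total degree `w`. -/
theorem sy_one_sub_mem (hG : ∀ n, ∀ u ∈ G, ∀ v ∈ G, (raOps F (Mat F 1)).mode n u v ∈ G)
    (h2 : sy F 1 i (1 - delta0 i) 0 1 ∈ G) {w : ℕ}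
    (hw : ∀ m n, m + n = w → sy F 1 i m n 1 ∈ G) (m n : ℕ) (hmn : m + n = w + 1) :
    sy F 1 i m n 1 - (-1 : F) ^ n • sy F 1 i (w + 1) 0 1 ∈ G := by
  induction n generalizing m with
  | zero => subst hmn; simp
  | succ n ih =>
    have h1 := ih (m + 1) (by omega)
    have h2 := sy_one_add_mem hG h2 (hw m n (by omega))
    have := sub_mem h2 h1
    rw [pow_succ]
    convert this using 1
    module

/-- By `sy_one_sub_mem`, once degree `w - 1` is known, degree `w` reduces to the class of `x^w`.
Exchanging the variables multiplies it by `(-1)ⁱ`, while modulo `G` it multiplies it by `(-1)^w`; if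
these signs differ the class is zero. Only the other parity needs `hstep`, that is, the second
generator. -/
theorem RStar_one_le_of_step (hG : ∀ n, ∀ u ∈ G, ∀ v ∈ G, (raOps F (Mat F 1)).mode n u v ∈ G)
    (h2 : sy F 1 i (1 - delta0 i) 0 1 ∈ G)
    (hstep : ∀ w, (-1 : F) ^ w = sgn F i → sy F 1 i w 0 1 ∈ G →
      sy F 1 i 2 w 1 - (-1 : F) ^ w • sy F 1 i (w + 2) 0 1 ∈ G → sy F 1 i (w + 2) 0 1 ∈ G) :
    RStar F 1 i ≤ G := by
  have hlow : ∀ w, (-1 : F) ^ w ≠ sgn F i →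
      sy F 1 i 0 w 1 - (-1 : F) ^ w • sy F 1 i w 0 1 ∈ G → sy F 1 i w 0 1 ∈ G := by
    intro w hw h
    rw [sy_one_swap i w 0, ← sub_smul] at h
    exact (Submodule.smul_mem_iff _ (sub_ne_zero.2 hw.symm)).1 h
  have hall : ∀ w, ∀ m n, m + n = w → sy F 1 i m n 1 ∈ G := by
    intro w
    induction w using Nat.strong_induction_on with
    | _ w ih =>
      have hred : sy F 1 i w 0 1 ∈ G → ∀ m n, m + n = w → sy F 1 i m n 1 ∈ G := by
        intro h m n hmn
        rcases w with _ | w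
        · obtain ⟨rfl, rfl⟩ := Nat.add_eq_zero_iff.1 hmn
          exact h
        · have := sy_one_sub_mem hG h2 (ih w (Nat.lt_succ_self w)) m n hmn
          exact (Submodule.sub_mem_iff_left _ (Submodule.smul_mem _ _ h)).1 this
      refine hred ?_
      by_cases hw : (-1 : F) ^ w = sgn F i
      -- The lowest degree of this parity, `0` for `i = 0` and `1` for `i = 1`, is the weight-two
      -- generator itself.
      · match w, ih, hw with
        | 0, _, hw =>
          have hd : delta0 i = 1 := by
            rcases Nat.le_one_iff_eq_zero_or_eq_one.1 (delta0_le_one i) with hd | hd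
            · have := neg_one_pow_delta0 (F := F) i
              rw [hd, ← hw] at this
              norm_num at this
            · exact hd
          rwa [hd] at h2
        | 1, _, hw =>
          have hd : delta0 i = 0 := by
            rcases Nat.le_one_iff_eq_zero_or_eq_one.1 (delta0_le_one i) with hd | hd
            · exact hd
            · have := neg_one_pow_delta0 (F := F) i
              rw [hd, ← hw] at this
              norm_num at this
          rwa [hd] at h2
        | w + 2, ih, hw =>
          have hw' : (-1 : F) ^ w = sgn F i := by rw [← hw, pow_add]; norm_num
          refine hstep w hw' (ih w (by omega) w 0 rfl) ?_
          exact sy_one_sub_mem hG h2 (ih (w + 1) (by omega)) 2 w (by omega)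
      · refine hlow w hw ?_
        rcases w with _ | w
        · simp
        · exact sy_one_sub_mem hG h2 (ih w (Nat.lt_succ_self w)) 0 (w + 1) (by omega)
  refine RStar_le fun m n a => ?_
  have ha : a = a 0 0 • 1 := by
    ext p q
    rw [Subsingleton.elim p 0, Subsingleton.elim q 0]
    simp
  rw [ha, map_smul]
  exact Submodule.smul_mem _ _ (hall _ m n rfl)

/-- For odd `w` the first product of the degree `(3, 0)` and `(w, 0)` elements is `(2w+3) sy(w+2,0)
- 3 sy(2,w)`. Modulo `G`, `sy(2,w)` is `-sy(w+2,0)`, so the coefficient becomes `2w + 6 ≠ 0`. -/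
theorem RStar_one_one_le (hG : ∀ n, ∀ u ∈ G, ∀ v ∈ G, (raOps F (Mat F 1)).mode n u v ∈ G)
    (h1 : sy F 1 1 1 0 1 ∈ G) (h3 : sy F 1 1 3 0 1 ∈ G) : RStar F 1 1 ≤ G := by
  have hd : delta0 1 = 0 := rfl
  have hs : sgn F 1 = -1 := by simp [sgn]
  refine RStar_one_le_of_step hG h1 fun w hw hwG hred => ?_
  have h := hG 1 _ h3 _ hwG
  rw [hs] at hw
  rw [mode_sy] at h
  simp only [syTerm, Matrix.transpose_one, mul_one, hd, hs, Nat.descFactorial_one, add_zero, pow_zero,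
    zero_add, Nat.cast_zero, hw] at h hred
  rw [show 3 + w - 1 = w + 2 by omega] at h
  have e : ((2 * w + 6 : ℕ) : F) • sy F 1 1 (w + 2) 0 1 =
      (w : F) • sy F 1 1 (w + 2) 0 1 +
        (-1 : F) • ((-1 : F) ^ 3 * ((3 + w : ℕ) : F)) • sy F 1 1 (w + 2) 0 1 +
        ((-1 : F) ^ 3 * ((3 : ℕ) : F)) • sy F 1 1 2 w 1 +
        (3 : F) • (sy F 1 1 2 w 1 - (-1 : F) • sy F 1 1 (w + 2) 0 1) := by
    push_cast
    module
  refine (Submodule.smul_mem_iff G (Nat.cast_ne_zero (R := F).2 (by omega : 2 * w + 6 ≠ 0))).1 ?_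
  rw [e]
  refine add_mem ?_ (Submodule.smul_mem _ _ hred)
  simpa using h

/-- For even `w` the first product is `-(2w+4) sy(w+2,0) - 4 sy(2,w)`, and `sy(2,w)` agrees with
`sy(w+2,0)` modulo `G`; the coefficient becomes `-(2w + 8) ≠ 0`. -/
theorem RStar_one_zero_le (hG : ∀ n, ∀ u ∈ G, ∀ v ∈ G, (raOps F (Mat F 1)).mode n u v ∈ G)
    (h0 : sy F 1 0 0 0 1 ∈ G) (h1 : sy F 1 0 1 1 1 ∈ G) : RStar F 1 0 ≤ G := by
  have hd : delta0 0 = 1 := rfl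
  have hs : sgn F 0 = 1 := by simp [sgn]
  refine RStar_one_le_of_step hG h0 fun w hw hwG hred => ?_
  have h := hG 1 _ h1 _ hwG
  rw [hs] at hw
  rw [mode_sy] at h
  simp only [syTerm, Matrix.transpose_one, mul_one, hd, hs, Nat.descFactorial_one, one_smul,
    hw] at h hred
  rw [show 1 + 1 + w + 1 - 1 = w + 2 by omega] at h
  have e : ((2 * w + 8 : ℕ) : F) • sy F 1 0 (w + 2) 0 1 =
      -(((-1 : F) ^ 1 * ((1 + w + 1 : ℕ) : F)) • sy F 1 0 (w + 2) 0 1 +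
        ((-1 : F) ^ 1 * ((1 + w + 1 : ℕ) : F)) • sy F 1 0 (w + 2) 0 1 +
        ((-1 : F) ^ 1 * ((1 + 0 + 1 : ℕ) : F)) • sy F 1 0 2 w 1 +
        ((-1 : F) ^ 1 * ((1 + 0 + 1 : ℕ) : F)) • sy F 1 0 2 w 1) -
        (4 : F) • (sy F 1 0 2 w 1 - sy F 1 0 (w + 2) 0 1) := by
    push_cast
    module
  refine (Submodule.smul_mem_iff G (Nat.cast_ne_zero (R := F).2 (by omega : 2 * w + 8 ≠ 0))).1 ?_
  rw [e]
  exact sub_mem (neg_mem h) (Submodule.smul_mem _ _ hred)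

end Generators

/-! ### The subspaces of weight two -/

section WeightTwo

variable {F : Type*} [Field F] {k : ℕ}

theorem apply_eq_zero_of_mem_weightSpace {A : Type*} [Ring A] [Algebra F A] {N : ℕ} {w : RA A}
    (hw : w ∈ weightSpace F A N) {i : Fin 2} {m n : ℕ} (h : m + n + (1 + delta0 i) ≠ N) :
    w (i, m, n) = 0 := by
  induction hw using Submodule.span_induction with
  | mem x hx =>
    obtain ⟨j, m', n', u, h', rfl⟩ := hx
    rw [elt, Finsupp.single_apply, if_neg]
    rintro ⟨⟩
    exact h h'
  | zero => rfl
  | add x y _ _ hx hy => rw [Finsupp.add_apply, hx, hy, add_zero]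
  | smul c x _ hx => rw [Finsupp.smul_apply, hx, smul_zero]

theorem elt_mem_weightSpace {A : Type*} [Ring A] [Algebra F A] {N : ℕ} {i : Fin 2} {m n : ℕ}
    (h : m + n + (1 + delta0 i) = N) (u : A) : elt i m n u ∈ weightSpace F A N :=
  Submodule.subset_span ⟨i, m, n, u, h, rfl⟩

theorem sy_mem_weightSpace {N : ℕ} {i : Fin 2} {m n : ℕ} (h : m + n + (1 + delta0 i) = N)
    (a : Mat F k) : sy F k i m n a ∈ weightSpace F (Mat F k) N := by
  rw [sy_eq_elt]
  exact Submodule.smul_mem _ _ (add_mem (elt_mem_weightSpace h _)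
    (Submodule.smul_mem _ _ (elt_mem_weightSpace (by omega) _)))

theorem mode_one_elt (a b : Mat F k) :
    (raOps F (Mat F k)).mode 1 (elt 0 0 0 a) (elt 0 0 0 b) = elt 0 0 0 (a * b + b * a) := by
  have h : ∀ c : Mat F k, elt 0 0 0 c = mon F 0 0 0 c := fun c => by simp [mon_eq]
  rw [h, h, h, mode_mon, map_add]
  simp [delta0]

theorem unitMat_mul_mul_unitMat (p q r s : Fin k) (a : Mat F k) :
    unitMat F k p q * a * unitMat F k r s = a q r • unitMat F k p s := by
  rw [unitMat, unitMat, Matrix.single_mul_mul_single, unitMat, Matrix.smul_single]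
  simp

theorem anticommutator_mem_symMat {a b : Mat F k} (ha : a ∈ SymMat F k) (hb : b ∈ SymMat F k) :
    a * b + b * a ∈ SymMat F k := by
  have ha' : a.transpose = a := ha
  have hb' : b.transpose = b := hb
  change Matrix.transpose _ = _
  rw [Matrix.transpose_add, Matrix.transpose_mul, Matrix.transpose_mul, ha', hb', add_comm]

variable [CharZero F]

theorem sy_mem_RStar1Two (a : Mat F k) : sy F k 1 1 0 a ∈ RStar1Two F k :=
  by
  refine Submodule.mem_inf.2 ⟨?_, sy_mem_weightSpace (by simp [delta0]) a⟩
  rw [RStar1_eq]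
  exact sy_mem 1 1 0 a

theorem sy_mem_RStar2Two (a : Mat F k) : sy F k 0 0 0 a ∈ RStar2Two F k :=
  by
  refine Submodule.mem_inf.2 ⟨?_, sy_mem_weightSpace (by simp [delta0]) a⟩
  rw [RStar2_eq]
  exact sy_mem 0 0 0 a

theorem exists_eq_sy_of_mem_RStar1Two {w : RA (Mat F k)} (hw : w ∈ RStar1Two F k) :
    ∃ a, w = sy F k 1 1 0 a := by
  obtain ⟨h1, h2⟩ := hw
  rw [RStar1_eq] at h1
  obtain ⟨hc, hs⟩ := RStar_symm h1
  refine ⟨w (1, 1, 0), ?_⟩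
  ext1 ⟨j, m, n⟩
  by_cases hj : j = 1
  · subst hj
    by_cases hmn : m + n = 1
    · rcases Nat.add_eq_one_iff.1 hmn with ⟨rfl, rfl⟩ | ⟨rfl, rfl⟩
      · rw [hs 1 0]
        simp [sy_apply, mon_apply]
      · simp [sy_apply, mon_apply]
    · rw [apply_eq_zero_of_mem_weightSpace h2 (by simp [delta0]; omega)]
      have h3 : ¬ (1 = m ∧ 0 = n) := by omega
      have h4 : ¬ (0 = m ∧ 1 = n) := by omega
      simp [sy_apply, mon_apply, h3, h4]
  · simp [hc j hj, sy_apply, mon_apply, Ne.symm hj]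

theorem mem_RStar2Two {w : RA (Mat F k)} :
    w ∈ RStar2Two F k ↔ ∃ a ∈ SymMat F k, w = elt 0 0 0 a := by
  constructor
  · rintro ⟨h1, h2⟩
    rw [RStar2_eq] at h1
    obtain ⟨hc, hs⟩ := RStar_symm h1
    refine ⟨w (0, 0, 0), ?_, ?_⟩
    · have := hs 0 0
      rw [sgn, Fin.val_zero, pow_zero, one_smul] at this
      exact this.symm
    · ext1 ⟨j, m, n⟩
      by_cases hj : (0, 0, 0) = (j, m, n)
      · rw [← hj, elt, Finsupp.single_eq_same]
      · rw [elt, Finsupp.single_apply, if_neg hj]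
        by_cases hj0 : j = 0
        · subst hj0
          refine apply_eq_zero_of_mem_weightSpace h2 fun h => hj ?_
          have : m = 0 ∧ n = 0 := by
            simp only [delta0, if_true] at h
            omega
          rw [this.1, this.2]
        · exact hc j hj0 m n
  · rintro ⟨a, ha, rfl⟩
    have ha' : a.transpose = a := ha
    have : elt 0 0 0 a = (2⁻¹ : F) • sy F k 0 0 0 a := by
      rw [sy_eq_elt, ha']
      simp only [sgn, Fin.val_zero, pow_zero, one_smul, Nat.factorial_zero, Nat.cast_one, mul_one,
        ← two_smul F (elt 0 0 0 a), smul_smul]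
      norm_num
    rw [this]
    exact Submodule.smul_mem _ _ (sy_mem_RStar2Two a)

theorem elt_mem_RStar2Two {a : Mat F k} (ha : a ∈ SymMat F k) : elt 0 0 0 a ∈ RStar2Two F k :=
  mem_RStar2Two.2 ⟨a, ha, rfl⟩

theorem RStar1Two_eq : RStar1Two F k = Submodule.span F {x | ∃ p q : Fin k,
    x = elt 1 1 0 (unitMat F k p q) - elt 1 0 1 (unitMat F k q p)} := by
  have hsy : ∀ p q : Fin k, elt 1 1 0 (unitMat F k p q) - elt 1 0 1 (unitMat F k q p) =
      sy F k 1 1 0 (unitMat F k p q) := fun p q => by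
    rw [← transpose_unitMat p q, elt_sub_eq_sy]
    simp
  refine le_antisymm (fun w hw => ?_) (Submodule.span_le.2 ?_)
  · obtain ⟨a, rfl⟩ := exists_eq_sy_of_mem_RStar1Two hw
    refine map_mem_of_unitMat (fun p q => ?_) a
    exact Submodule.subset_span ⟨p, q, (hsy p q).symm⟩
  · rintro _ ⟨p, q, rfl⟩
    rw [hsy]
    exact sy_mem_RStar1Two _

theorem RStar2Two_eq : RStar2Two F k = Submodule.span F {x | ∃ p q : Fin k,
    x = elt 0 0 0 (unitMat F k p q) + elt 0 0 0 (unitMat F k q p)} := by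
  have hsy : ∀ p q : Fin k, elt 0 0 0 (unitMat F k p q) + elt 0 0 0 (unitMat F k q p) =
      sy F k 0 0 0 (unitMat F k p q) := fun p q => by
    rw [← transpose_unitMat p q, elt_add_eq_sy_zero]
    simp
  refine le_antisymm (fun w hw => ?_) (Submodule.span_le.2 ?_)
  · obtain ⟨a, ha, rfl⟩ := mem_RStar2Two.1 hw
    have ha' : a.transpose = a := ha
    have : elt 0 0 0 a = (2⁻¹ : F) • sy F k 0 0 0 a := by
      have h := elt_add_eq_sy_zero (F := F) 0 0 a
      rw [ha', ← two_smul F (elt 0 0 0 a)] at h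
      simp only [Nat.factorial_zero, Nat.cast_one, mul_one, inv_one, one_smul] at h
      rw [← h, smul_smul, inv_mul_cancel₀ two_ne_zero, one_smul]
    rw [this]
    refine Submodule.smul_mem _ _ (map_mem_of_unitMat (fun p q => ?_) a)
    exact Submodule.subset_span ⟨p, q, (hsy p q).symm⟩
  · rintro _ ⟨p, q, rfl⟩
    rw [hsy]
    exact sy_mem_RStar2Two _

/-! ### The Jordan algebra -/

/-- A nonzero space of symmetric matrices that is closed under anticommutators with symmetric
matrices contains all symmetric matrices. -/
theorem symMat_le_of_anticommutator_mem {J : Submodule F (Mat F k)} (hJ : J ≤ SymMat F k)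
    (hne : J ≠ ⊥) (h : ∀ a ∈ SymMat F k, ∀ b ∈ J, a * b + b * a ∈ J) : SymMat F k ≤ J := by
  have hsym : ∀ p q : Fin k, unitMat F k p q + unitMat F k q p ∈ SymMat F k := by
    intro p q
    change Matrix.transpose _ = _
    rw [Matrix.transpose_add, transpose_unitMat, transpose_unitMat, add_comm]
  have hdiag : ∀ p : Fin k, unitMat F k p p ∈ SymMat F k := fun p => transpose_unitMat p p
  have hspread : ∀ p r : Fin k, unitMat F k p p ∈ J → unitMat F k p r + unitMat F k r p ∈ J := by
    intro p r hp
    by_cases hpr : p = r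
    · subst hpr; exact add_mem hp hp
    · have := h _ (hsym p r) _ hp
      simpa [add_mul, mul_add, unitMat_mul_same, unitMat_mul_of_ne hpr,
        unitMat_mul_of_ne (Ne.symm hpr), add_comm] using this
  have hoff : ∀ p q : Fin k, p ≠ q → unitMat F k p q + unitMat F k q p ∈ J →
      unitMat F k p p ∈ J := by
    intro p q hpq hmem
    have h1 := h _ (hdiag p) _ (h _ (hsym p q) _ hmem)
    simp only [add_mul, mul_add, unitMat_mul_same, unitMat_mul_of_ne hpq,
        unitMat_mul_of_ne (Ne.symm hpq), add_zero, zero_add] at h1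
    have e : unitMat F k p p + unitMat F k p p + (unitMat F k p p + unitMat F k p p) =
        (4 : F) • unitMat F k p p := by module
    rw [e] at h1
    exact (Submodule.smul_mem_iff _ (by norm_num : (4 : F) ≠ 0)).1 h1
  have hall : ∀ p, unitMat F k p p ∈ J → ∀ r, unitMat F k r r ∈ J := by
    intro p hp r
    by_cases hpr : p = r
    · exact hpr ▸ hp
    · refine hoff r p (Ne.symm hpr) ?_
      rw [add_comm]
      exact hspread p r hp
  obtain ⟨p, hp⟩ : ∃ p, unitMat F k p p ∈ J := by
    obtain ⟨x, hx, hx0⟩ := Submodule.exists_mem_ne_zero_of_ne_bot hne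
    have hxs : x.transpose = x := hJ hx
    obtain ⟨p, q, hpq⟩ : ∃ p q, x p q ≠ 0 := by
      by_contra! h0
      exact hx0 (Matrix.ext h0)
    refine ⟨p, ?_⟩
    by_cases hpp : x p p = 0
    · have hne : p ≠ q := fun e => hpq (e ▸ hpp)
      refine hoff p q hne ?_
      -- Anticommuting with `E_qq` and then with `E_pp` leaves only the entries at `(p, q)` and `(q,
      -- p)`.
      have h1 := h _ (hdiag p) _ (h _ (hdiag q) _ hx)
      have hqp : x q p = x p q := congrFun (congrFun hxs p) q
      have e : unitMat F k p p * (unitMat F k q q * x + x * unitMat F k q q) +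
          (unitMat F k q q * x + x * unitMat F k q q) * unitMat F k p p =
          x p q • (unitMat F k p q + unitMat F k q p) := by
        rw [mul_add, add_mul, ← mul_assoc, ← mul_assoc, unitMat_mul_of_ne hne, zero_mul, zero_add,
          mul_assoc x, unitMat_mul_of_ne hne.symm, mul_zero, add_zero, unitMat_mul_mul_unitMat,
          unitMat_mul_mul_unitMat, hqp, smul_add]
      rw [e] at h1
      exact (Submodule.smul_mem_iff _ hpq).1 h1
    · have h1 := h _ (hdiag p) _ hx
      -- The anticommutator `T` with `E_pp` has eigenvalue `2` on the `(p, p)` entry, `1` on the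
      -- rest of row and column `p`, and `0` elsewhere, so `T² - T` isolates the `(p, p)` entry.
      have h2 := sub_mem (h _ (hdiag p) _ h1) h1
      have e : unitMat F k p p * (unitMat F k p p * x + x * unitMat F k p p) +
          (unitMat F k p p * x + x * unitMat F k p p) * unitMat F k p p -
          (unitMat F k p p * x + x * unitMat F k p p) = (2 * x p p) • unitMat F k p p := by
        rw [mul_add, add_mul, ← mul_assoc, ← mul_assoc, mul_assoc x, unitMat_mul_same,
          unitMat_mul_mul_unitMat, mul_smul]
        module
      rw [e] at h2
      exact (Submodule.smul_mem_iff _ (mul_ne_zero two_ne_zero hpp)).1 h2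
  intro a ha
  have ha' : a.transpose = a := ha
  have hmem : ∀ p q, (LinearMap.id + (Matrix.transposeLinearEquiv (Fin k) (Fin k) F F).toLinearMap :
      Mat F k →ₗ[F] Mat F k) (unitMat F k p q) ∈ J := by
    intro r s
    change unitMat F k r s + (unitMat F k r s).transpose ∈ J
    rw [transpose_unitMat]
    exact hspread r s (hall p hp r)
  have h2 : a + a.transpose ∈ J := map_mem_of_unitMat hmem a
  rw [ha', ← two_smul F] at h2
  exact (Submodule.smul_mem_iff _ two_ne_zero).1 h2

theorem isSimpleJordan_RStar2Two (hk : 0 < k) :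
    IsSimpleJordan ((raOps F (Mat F k)).mode 1) (RStar2Two F k) where
  mul_mem := by
    intro x hx y hy
    obtain ⟨a, ha, rfl⟩ := mem_RStar2Two.1 hx
    obtain ⟨b, hb, rfl⟩ := mem_RStar2Two.1 hy
    rw [mode_one_elt]
    exact elt_mem_RStar2Two (anticommutator_mem_symMat ha hb)
  comm := by
    intro x hx y hy
    obtain ⟨a, ha, rfl⟩ := mem_RStar2Two.1 hx
    obtain ⟨b, hb, rfl⟩ := mem_RStar2Two.1 hy
    rw [mode_one_elt, mode_one_elt, add_comm]
  jordan := by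
    intro x hx y hy
    obtain ⟨a, ha, rfl⟩ := mem_RStar2Two.1 hx
    obtain ⟨b, hb, rfl⟩ := mem_RStar2Two.1 hy
    simp only [mode_one_elt]
    congr 1
    noncomm_ring
  mul_ne_zero := by
    have h1 : (1 : Mat F k) ∈ SymMat F k := Matrix.transpose_one
    refine ⟨_, elt_mem_RStar2Two h1, _, elt_mem_RStar2Two h1, ?_⟩
    rw [mode_one_elt, elt, Ne, Finsupp.single_eq_zero]
    intro h0
    have := congrFun (congrFun h0 ⟨0, hk⟩) ⟨0, hk⟩
    norm_num at this
  ideals := by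
    intro J hJ hmul
    let ι : Mat F k →ₗ[F] RA (Mat F k) := Finsupp.lsingle (0, 0, 0)
    have hι : ∀ a, ι a = elt 0 0 0 a := fun _ => rfl
    by_cases hne : J.comap ι = ⊥
    · refine Or.inl ((Submodule.eq_bot_iff _).2 fun x hx => ?_)
      obtain ⟨a, ha, rfl⟩ := mem_RStar2Two.1 (hJ hx)
      have : a ∈ J.comap ι := hx
      rw [hne, Submodule.mem_bot] at this
      rw [this, ← hι, map_zero]
    · refine Or.inr (le_antisymm hJ fun x hx => ?_)
      obtain ⟨a, ha, rfl⟩ := mem_RStar2Two.1 hx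
      refine symMat_le_of_anticommutator_mem (J := J.comap ι) (fun b hb => ?_) hne
        (fun c hc b hb => ?_) ha
      · obtain ⟨c, hc, hbc⟩ := mem_RStar2Two.1 (hJ hb)
        rwa [Finsupp.single_injective _ hbc]
      · rw [Submodule.mem_comap, hι, ← mode_one_elt]
        exact hmul _ (elt_mem_RStar2Two hc) _ hb

/-- The map is `a ↦ a/2`: it absorbs the factor `1/2` in `a ∘ b`, since `u_1 v` is the full
anticommutator `uv + vu`. -/
theorem exists_symMat_equiv : ∃ φ : SymMat F k ≃ₗ[F] RStar2Two F k, ∀ a b : SymMat F k,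
    (φ (symMul F k a b) : RA (Mat F k)) = (raOps F (Mat F k)).mode 1 (φ a) (φ b) := by
  let ψ : SymMat F k →ₗ[F] RStar2Two F k := LinearMap.codRestrict _
    (((2⁻¹ : F) • Finsupp.lsingle (0, 0, 0)) ∘ₗ (SymMat F k).subtype)
    fun a => Submodule.smul_mem _ (2⁻¹ : F) (elt_mem_RStar2Two a.2)
  have hψ : ∀ a : SymMat F k, (ψ a : RA (Mat F k)) = (2⁻¹ : F) • elt 0 0 0 (a : Mat F k) :=
    fun _ => rfl
  have hinj : Function.Injective ψ := by
    intro a b hab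
    have h := congrArg (Subtype.val) hab
    rw [hψ, hψ] at h
    exact Subtype.ext (Finsupp.single_injective _
      (smul_right_injective _ (inv_ne_zero (two_ne_zero (α := F))) h))
  have hsurj : Function.Surjective ψ := by
    rintro ⟨w, hw⟩
    obtain ⟨a, ha, rfl⟩ := mem_RStar2Two.1 hw
    refine ⟨(2 : F) • ⟨a, ha⟩, Subtype.ext ?_⟩
    rw [map_smul, Submodule.coe_smul, hψ, smul_smul, mul_inv_cancel₀ two_ne_zero, one_smul]
  refine ⟨LinearEquiv.ofBijective ψ ⟨hinj, hsurj⟩, fun a b => ?_⟩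
  change (ψ (symMul F k a b) : RA (Mat F k)) = (raOps F (Mat F k)).mode 1 (ψ a) (ψ b)
  have helt : ∀ (c : F) (u : Mat F k), elt 0 0 0 (c • u) = c • elt 0 0 0 u := fun c u =>
    (Finsupp.smul_single c _ u).symm
  rw [hψ, hψ, hψ, map_smul, map_smul, LinearMap.smul_apply, mode_one_elt, symMul, helt]

/-! ### Generation by the components of low weight -/

theorem generatedBy_RStar1Two (hk : 1 < k) :
    generatedBy (raOps F (Mat F k)) (RStar1Two F k : Set (RA (Mat F k))) = RStar1 F k := by
  rw [RStar1_eq]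
  refine le_antisymm (generatedBy_le (fun x hx => RStar1_eq F k ▸ hx.1) fun n u hu v hv =>
    mode_mem_RStar 1 n u (RStar1_eq F k ▸ hu.1) v hv) (RStar_le_of_weight_two_mem hk
    (fun n u hu v hv => mode_mem_generatedBy hu n hv)
    fun a => subset_generatedBy (sy_mem_RStar1Two a))

theorem generatedBy_RStar2Two (hk : 1 < k) :
    generatedBy (raOps F (Mat F k)) (RStar2Two F k : Set (RA (Mat F k))) = RStar2 F k := by
  rw [RStar2_eq]
  refine le_antisymm (generatedBy_le (fun x hx => RStar2_eq F k ▸ hx.1) fun n u hu v hv =>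
    mode_mem_RStar 0 n u (RStar2_eq F k ▸ hu.1) v hv) (RStar_le_of_weight_two_mem hk
    (fun n u hu v hv => mode_mem_generatedBy hu n hv)
    fun a => subset_generatedBy (sy_mem_RStar2Two a))

theorem generatedBy_RStar1_one : generatedBy (raOps F (Mat F 1))
    {elt 1 1 0 (1 : Mat F 1) - elt 1 0 1 1, elt 1 3 0 (1 : Mat F 1) - elt 1 0 3 1} =
      RStar1 F 1 := by
  have h1 := elt_sub_eq_sy (F := F) (k := 1) 1 0 1
  have h3 := elt_sub_eq_sy (F := F) (k := 1) 3 0 1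
  rw [Matrix.transpose_one] at h1 h3
  rw [RStar1_eq, h1, h3]
  have hS : ({((Nat.factorial 1 : F) * (Nat.factorial 0 : F))⁻¹ • sy F 1 1 1 0 1,
      ((Nat.factorial 3 : F) * (Nat.factorial 0 : F))⁻¹ • sy F 1 1 3 0 1} : Set (RA (Mat F 1))) ⊆
      RStar F 1 1 := by
    rintro _ (rfl | rfl) <;> exact Submodule.smul_mem _ _ (sy_mem _ _ _ _)
  have h0 : ∀ m n : ℕ, ((m.factorial : F) * (n.factorial : F))⁻¹ ≠ 0 := fun m n =>
    inv_ne_zero (mul_ne_zero (Nat.cast_ne_zero.2 m.factorial_ne_zero)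
      (Nat.cast_ne_zero.2 n.factorial_ne_zero))
  refine le_antisymm (generatedBy_le hS fun n u hu v hv => mode_mem_RStar 1 n u (hS hu) v hv)
    (RStar_one_one_le (fun n u hu v hv => mode_mem_generatedBy hu n hv) ?_ ?_)
  · exact (Submodule.smul_mem_iff _ (h0 1 0)).1 (subset_generatedBy (Or.inl rfl))
  · exact (Submodule.smul_mem_iff _ (h0 3 0)).1 (subset_generatedBy (Or.inr rfl))

theorem generatedBy_RStar2_one : generatedBy (raOps F (Mat F 1))
    {elt 0 0 0 (1 : Mat F 1), elt 0 1 1 (1 : Mat F 1)} = RStar2 F 1 := by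
  have h (m : ℕ) : sy F 1 0 m m 1 =
      ((m.factorial : F) * (m.factorial : F)) • ((2 : F) • elt 0 m m (1 : Mat F 1)) := by
    rw [sy_eq_elt, Matrix.transpose_one, two_smul]
    simp [sgn]
  have h0 (m : ℕ) : ((m.factorial : F) * (m.factorial : F)) ≠ 0 :=
    mul_ne_zero (Nat.cast_ne_zero.2 m.factorial_ne_zero) (Nat.cast_ne_zero.2 m.factorial_ne_zero)
  have helt (m : ℕ) : elt 0 m m (1 : Mat F 1) ∈ RStar F 1 0 := by
    have := sy_mem (F := F) (k := 1) 0 m m 1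
    rw [h] at this
    exact (Submodule.smul_mem_iff _ two_ne_zero).1 ((Submodule.smul_mem_iff _ (h0 m)).1 this)
  have hS : ({elt 0 0 0 (1 : Mat F 1), elt 0 1 1 (1 : Mat F 1)} : Set (RA (Mat F 1))) ⊆
      RStar F 1 0 := by
    rintro _ (rfl | rfl) <;> exact helt _
  rw [RStar2_eq]
  refine le_antisymm (generatedBy_le hS fun n u hu v hv => mode_mem_RStar 0 n u (hS hu) v hv)
    (RStar_one_zero_le (fun n u hu v hv => mode_mem_generatedBy hu n hv) ?_ ?_)
  · rw [h]
    exact Submodule.smul_mem _ _ (Submodule.smul_mem _ _ (subset_generatedBy (Or.inl rfl)))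
  · rw [h]
    exact Submodule.smul_mem _ _ (Submodule.smul_mem _ _ (subset_generatedBy (Or.inr rfl)))

end WeightTwo

end ConformalMatrix

open ConformalMatrix in
theorem theorem3p2 {F : Type*} [Field F] [CharZero F] (k : ℕ) (hk : 0 < k) :
    -- both are conformal subalgebras of `R(A)^σ`, with `σ` the transpose
    (RStar1 F k ≤ RSigma F (Matrix.transpose : Mat F k → Mat F k) ∧
      IsConformalAlgebra (raOps F (Mat F k)) (RStar1 F k)) ∧
    (RStar2 F k ≤ RSigma F (Matrix.transpose : Mat F k → Mat F k) ∧
      IsConformalAlgebra (raOps F (Mat F k)) (RStar2 F k)) ∧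
    -- both are simple
    IsSimpleConformal (raOps F (Mat F k)) (RStar1 F k) ∧
    IsSimpleConformal (raOps F (Mat F k)) (RStar2 F k) ∧
    -- the subspaces of weight 2
    RStar1Two F k = Submodule.span F {x | ∃ p q : Fin k,
      x = elt 1 1 0 (unitMat F k p q) - elt 1 0 1 (unitMat F k q p)} ∧
    RStar2Two F k = Submodule.span F {x | ∃ p q : Fin k,
      x = elt 0 0 0 (unitMat F k p q) + elt 0 0 0 (unitMat F k q p)} ∧
    -- generators
    (1 < k → generatedBy (raOps F (Mat F k)) (RStar1Two F k : Set (RA (Mat F k))) = RStar1 F k) ∧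
    (1 < k → generatedBy (raOps F (Mat F k)) (RStar2Two F k : Set (RA (Mat F k))) = RStar2 F k) ∧
    (k = 1 → generatedBy (raOps F (Mat F k))
      {elt 1 1 0 (1 : Mat F k) - elt 1 0 1 1, elt 1 3 0 (1 : Mat F k) - elt 1 0 3 1} =
        RStar1 F k) ∧
    (k = 1 → generatedBy (raOps F (Mat F k))
      {elt 0 0 0 (1 : Mat F k), elt 0 1 1 (1 : Mat F k)} = RStar2 F k) ∧
    -- the weight-2 part of the second one, under `u ⊙ v = u(0)v = u_1 v`, is the simple Jordan
    -- algebra of symmetric matrices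
    IsSimpleJordan ((raOps F (Mat F k)).mode 1) (RStar2Two F k) ∧
    ∃ φ : SymMat F k ≃ₗ[F] RStar2Two F k, ∀ a b : SymMat F k,
      (φ (symMul F k a b) : RA (Mat F k)) = (raOps F (Mat F k)).mode 1 (φ a) (φ b) := by
  refine ⟨⟨?_, ?_⟩, ⟨?_, ?_⟩, ?_, ?_, RStar1Two_eq, RStar2Two_eq, generatedBy_RStar1Two,
    generatedBy_RStar2Two, ?_, ?_, isSimpleJordan_RStar2Two hk, exists_symMat_equiv⟩
  · rw [RStar1_eq]
    exact RStar_le_RSigma 1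
  · rw [RStar1_eq]
    exact isConformalAlgebra_of_closed (del_mem_RStar 1) (mode_mem_RStar 1)
  · rw [RStar2_eq]
    exact RStar_le_RSigma 0
  · rw [RStar2_eq]
    exact isConformalAlgebra_of_closed (del_mem_RStar 0) (mode_mem_RStar 0)
  · rw [RStar1_eq]
    exact isSimpleConformal_RStar hk 1
  · rw [RStar2_eq]
    exact isSimpleConformal_RStar hk 0
  · rintro rfl
    exact generatedBy_RStar1_one
  · rintro rfl
    exact generatedBy_RStar2_one
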